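/- Let $\Omega=(l_1,l_2)\times(l_3,l_4)$ be a rectangle, $\Gamma_1=\{l_1\}\times(l_3,l_4)$ its left side, and $P=(l_1,y_0)\in\Gamma_1$ a side point. Let $a>0$ be a coefficient on $\overline\Omega$ with partial derivatives up to order $6$, and $\alpha$ a function on the side with derivatives up to order $5$, all continuous up to the boundary. (For an elliptic interface problem, $\overline\Omega$ is any closed rectangle that is adjacent to the side point and does not meet the interface.) Consider $$-\nabla\cdot(a\nabla u)=f\ \text{ in }\Omega,\qquad \mathcal B_1u:=\frac{\partial u}{\partial\vec n}+\alpha u=-u_x+\alpha u=g_1\ \text{ on }\Gamma_1,$$ where $u$ is $C^7$ and $f$, $g_1$ are $C^5$ up to the boundary. Write $w^{(m,n)}=\partial_x^m\partial_y^nw(P)$ for functions of two variables and $b^{(n)}=b^{(n)}(y_0)$ for functions on $\Gamma_1$. Let $\Lambda_K=\{(m,n)\in\mathbb Z_{\ge0}^2: m+n\le K\}$ and $\Lambda^{V,2}_K=\{(m,n)\in\Lambda_K:m\ge2\}$. Differentiating the equation at $P$ expresses each $u^{(m',n')}$ with $m'\ge 2$ uniquely as a linear combination of $u^{(0,n)}$,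 $u^{(1,n)}$ and $f^{(m,n)}$; let $A^{u}_{m',n',m,n}$ ($m\in\{0,1\}$) and $A^{f}_{m',n',m,n}$ be the coefficients of $u^{(m,n)}$ and of $f^{(m,n)}$ (they depend only on the derivatives of $a$ at $P$). For $m\in\{0,1\}$ put $$G_{m,n}(x,y)=\sum_{\ell=0}^{\lfloor n/2\rfloor}\frac{(-1)^\ell x^{m+2\ell}y^{n-2\ell}}{(m+2\ell)!\,(n-2\ell)!}+\sum_{(m',n')\in\Lambda^{V,2}_{6}\setminus\Lambda^{V,2}_{m+n}}A^{u}_{m',n',m,n}\frac{x^{m'}y^{n'}}{m'!\,n'!},$$ and for $(m,n)\in\Lambda_4$ $$Q_{m,n}(x,y)=\sum_{\ell=1}^{1+\lfloor n/2\rfloor}\frac{(-1)^\ell x^{m+2\ell}y^{n-2\ell+2}}{(m+2\ell)!\,(n-2\ell+2)!}\,\frac1{a(P)}+\sum_{(m',n')\in\Lambda^{V,2}_{6}\setminus\Lambda^{V,2}_{m+n+2}}A^{f}_{m',n',m,n}\frac{x^{m'}y^{n'}}{m'!\,n'!}.$$ For real numbers $c_{k,\ell,i}$ ($k\in\{0,1\}$,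 $\ell\in\{-1,0,1\}$, $0\le i\le6$) let $C_{k,\ell}(h)=\sum_{i=0}^6c_{k,\ell,i}h^i$, and consider the linear system for the $c_{k,\ell,i}$ induced by $$\sum_{k,\ell}C_{k,\ell}(h)\Big(G_{0,n}(kh,\ell h)+\sum_{i=n}^{5}\binom in\alpha^{(i-n)}G_{1,i}(kh,\ell h)\Big)=\mathcal O(h^7)\quad(h\to0^+),\qquad n=0,1,\dots,6 \qquad(*)$$ (the inner sum is empty for $n=6$). Consider further the 6-point scheme $$\mathcal L_hu:=\sum_{k,\ell}C_{k,\ell}(h)\,u(l_1+kh,y_0+\ell h)=\sum_{(m,n)\in\Lambda_4}f^{(m,n)}C_{f,m,n}+\sum_{n=0}^5g_1^{(n)}C_{g_1,n},\qquad(**)$$ $$C_{f,m,n}=\sum_{k,\ell}C_{k,\ell}\,Q_{m,n}(kh,\ell h),\qquad C_{g_1,n}=-\sum_{k,\ell}C_{k,\ell}\,G_{1,n}(kh,\ell h).$$ 1. For every solution of $(*)$ the scheme $(**)$, scaled by $h^{-1}$, has truncation error of sixth order for $\mathcal B_1u=g_1$ at $P$: for all exact $u,f,g_1$ as above, $h^{-1}\big(\mathcal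 L_hu-\text{right-hand side}\big)=\mathcal O(h^6)$ as $h\to0^+$. If the solution is nontrivial in the sense that $c_{k,\ell,0}\ne0$ for some $(k,\ell)$, then moreover $h^{-1}\mathcal L_hw\to\kappa\,\mathcal B_1w(P)$ for every $w\in C^1(\overline\Omega)$, with a constant $\kappa\neq0$ independent of $w$. The system $(*)$ always has such a nontrivial solution. 2. Six is the maximum order of a 6-point scheme at $P$. Call a 6-point scheme any relation $\sum_{k,\ell}C_{k,\ell}(h)u(l_1+kh,y_0+\ell h)=\sum_{m+n\le K}f^{(m,n)}C_{f,m,n}(h)+\sum_{n\le K'}g_1^{(n)}C_{g_1,n}(h)$ on the same six points, with arbitrary finite $K,K'$, arbitrary functions of $h$ as coefficients, and the $C_{k,\ell}(h)$ not all tending to $0$ as $h\to0^+$; it has order $p\in\mathbb Z_{\ge 0}$ if $h^{-1}$ times the difference of its two sides is $\mathcal O(h^p)$ as $h\to0^+$ for all exact $u,f,g_1$ that are $C^\infty$ up to the boundary. Then $6$ is the greatest $p$ such that for all $C^\infty$ functions $\alpha$ and $a>0$ (up to the boundary) there is a 6-point scheme of order $p$ at $P$. Moreover, for each individual such pair $(a,\alpha)$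 with $2a(P)\alpha(y_0)+a_x(P)\ne0$, $6$ is the greatest order of a 6-point scheme at $P$. -/

import Mathlib

open Set Filter Topology Asymptotics
open scoped ContDiff

/-- A rectangle `Ω = (l₁, l₂) × (l₃, l₄)` with a side point `(l₁, y₀)` of its left side
`Γ₁ = {l₁} × (l₃, l₄)`. -/
structure SideRect where
  l₁ : ℝ
  l₂ : ℝ
  l₃ : ℝ
  l₄ : ℝ
  y₀ : ℝ
  hx : l₁ < l₂
  hy₃ : l₃ < y₀
  hy₄ : y₀ < l₄

/-- The index set `Λ_K = {(m, n) : m + n ≤ K}`. -/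
def Lam (K : ℕ) : Finset (ℕ × ℕ) :=
  (Finset.range (K + 1) ×ˢ Finset.range (K + 1)).filter (fun p => p.1 + p.2 ≤ K)

/-- The index set `Λ_K^{V,2} = Λ_K \ Λ_K^{V,1}`, where `Λ_K^{V,1}` consists of the
`(m, n) ∈ Λ_K` with `m ∈ {0, 1}`. -/
def LamV2 (K : ℕ) : Finset (ℕ × ℕ) := (Lam K).filter (fun p => 2 ≤ p.1)

/-- The six stencil offsets `(k, ℓ)`, `k ∈ {0, 1}`, `ℓ ∈ {-1, 0, 1}`. -/
def stencil : Finset (ℤ × ℤ) := ({0, 1} : Finset ℤ) ×ˢ ({-1, 0, 1} : Finset ℤ)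

/-- Formal differentiation of `-∇·(a∇u) = f`, that is, of
`u_xx = - u_yy - (log a)_x u_x - (log a)_y u_y - f / a`.
Given the derivatives `L i j` of `log a`, `R i j` of `1 / a` and `F i j` of `f` at the base point,
together with the values `φ 0 n` of `∂_y^n u` and `φ 1 n` of `∂_x ∂_y^n u` there, `formalJet` computes
`∂_x^m ∂_y^n u` at the base point by applying `∂_x^m ∂_y^n` to this equation (Leibniz rule). -/
noncomputable def formalJet (L R φ F : ℕ → ℕ → ℝ) : ℕ → ℕ → ℝ
  | 0, n => φ 0 n
  | 1, n => φ 1 n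
  | m + 2, n =>
      - formalJet L R φ F m (n + 2)
      - ∑ i ∈ Finset.range (m + 1), ∑ j ∈ Finset.range (n + 1),
          ((m.choose i : ℝ) * (n.choose j : ℝ)) *
            (L (i + 1) j * formalJet L R φ F (m - i + 1) (n - j)
              + L i (j + 1) * formalJet L R φ F (m - i) (n - j + 1)
              + R i j * F (m - i) (n - j))
termination_by m _ => m

/-- The Kronecker symbol `δ_{(i,j),(m,n)}`. -/
def kron (m n i j : ℕ) : ℝ := if i = m ∧ j = n then 1 else 0

namespace SideRect

variable (D : SideRect)

/-- The open rectangle `Ω`. -/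
def Omega : Set (ℝ × ℝ) := Ioo D.l₁ D.l₂ ×ˢ Ioo D.l₃ D.l₄

/-- The closed rectangle. -/
def OmegaBar : Set (ℝ × ℝ) := Icc D.l₁ D.l₂ ×ˢ Icc D.l₃ D.l₄

/-- `w` has partial derivatives up to order `r` that extend continuously to the closed rectangle
(equivalently, are uniformly continuous in the rectangle). -/
def SmoothOn (r : ℕ∞) (w : ℝ → ℝ → ℝ) : Prop :=
  ContDiffOn ℝ (r : WithTop ℕ∞) (fun z : ℝ × ℝ => w z.1 z.2) D.OmegaBar

/-- `b` has derivatives up to order `r` that extend continuously to the closed side. -/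
def SmoothSide (r : ℕ∞) (b : ℝ → ℝ) : Prop :=
  ContDiffOn ℝ (r : WithTop ℕ∞) b (Icc D.l₃ D.l₄)

/-- `w^{(m,n)}`, the partial derivative `∂_x^m ∂_y^n w` at the base point `(l₁, y₀)`
(one-sided in `x`, the base point being on the left side). -/
noncomputable def pd (w : ℝ → ℝ → ℝ) (m n : ℕ) : ℝ :=
  iteratedDerivWithin m
    (fun x => iteratedDerivWithin n (fun y => w x y) (Icc D.l₃ D.l₄) D.y₀) (Icc D.l₁ D.l₂) D.l₁

/-- `b^{(n)}`, the `n`-th derivative at `y₀` of a function on the left side. -/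
noncomputable def bd (b : ℝ → ℝ) (n : ℕ) : ℝ := iteratedDeriv n b D.y₀

/-- The Robin operator `∂w/∂n + α w` at the point `(l₁, y)` of the left side, where the outward unit
normal is `(-1, 0)`. -/
noncomputable def robin (α : ℝ → ℝ) (w : ℝ → ℝ → ℝ) (y : ℝ) : ℝ :=
  - derivWithin (fun x => w x y) (Icc D.l₁ D.l₂) D.l₁ + α y * w D.l₁ y

/-- `u` is an exact solution, with data `f` and `g₁`, of `-∇·(a∇u) = f` in `Ω` with
`∂u/∂n + α u = g₁` on `Γ₁`; `u` is of class `C^{r+2}` and the data are of class `C^r`, up to the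
boundary. -/
structure IsExactSolution (a : ℝ → ℝ → ℝ) (α : ℝ → ℝ) (r : ℕ∞)
    (u f : ℝ → ℝ → ℝ) (g₁ : ℝ → ℝ) : Prop where
  smooth_u : D.SmoothOn (r + 2) u
  smooth_f : D.SmoothOn r f
  smooth_g : D.SmoothSide r g₁
  pde : ∀ x ∈ Ioo D.l₁ D.l₂, ∀ y ∈ Ioo D.l₃ D.l₄,
    - (deriv (fun s => a s y * deriv (fun t => u t y) s) x
        + deriv (fun s => a x s * deriv (fun t => u x t) s) y) = f x y
  bc : ∀ y ∈ Ioo D.l₃ D.l₄, D.robin α u y = g₁ y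

/-- `A^{V,u}_{m',n',m,n}`: the coefficient of `u^{(m,n)}` (`m ∈ {0, 1}`) when `u^{(m',n')}` is expressed,
by means of the differential equation, through the `u^{(0,·)}`, `u^{(1,·)}` and the derivatives
of `f`. -/
noncomputable def AVu (a : ℝ → ℝ → ℝ) (m' n' m n : ℕ) : ℝ :=
  formalJet (D.pd fun x y => Real.log (a x y)) (D.pd fun x y => (a x y)⁻¹)
    (kron m n) (fun _ _ => 0) m' n'

/-- `A^{V,f}_{m',n',m,n}`: the coefficient of `f^{(m,n)}` in the same expression of `u^{(m',n')}`. -/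
noncomputable def AVf (a : ℝ → ℝ → ℝ) (m' n' m n : ℕ) : ℝ :=
  formalJet (D.pd fun x y => Real.log (a x y)) (D.pd fun x y => (a x y)⁻¹)
    (fun _ _ => 0) (kron m n) m' n'

/-- The polynomial `G^V_{M,m,n}(x, y)`. -/
noncomputable def GV (a : ℝ → ℝ → ℝ) (M m n : ℕ) (x y : ℝ) : ℝ :=
  ∑ l ∈ Finset.range (n / 2 + 1),
      (-1 : ℝ) ^ l * x ^ (m + 2 * l) * y ^ (n - 2 * l)
        / (((m + 2 * l).factorial : ℝ) * ((n - 2 * l).factorial : ℝ))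
    + ∑ p ∈ LamV2 (M + 1) \ LamV2 (m + n),
      D.AVu a p.1 p.2 m n * (x ^ p.1 * y ^ p.2 / ((p.1.factorial : ℝ) * (p.2.factorial : ℝ)))

/-- The polynomial `Q^V_{M,m,n}(x, y)`. -/
noncomputable def QV (a : ℝ → ℝ → ℝ) (M m n : ℕ) (x y : ℝ) : ℝ :=
  ∑ l ∈ Finset.Icc 1 (1 + n / 2),
      (-1 : ℝ) ^ l * x ^ (m + 2 * l) * y ^ (n + 2 - 2 * l)
        / (((m + 2 * l).factorial : ℝ) * ((n + 2 - 2 * l).factorial : ℝ)) * (1 / a D.l₁ D.y₀)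
    + ∑ p ∈ LamV2 (M + 1) \ LamV2 (m + n + 2),
      D.AVf a p.1 p.2 m n * (x ^ p.1 * y ^ p.2 / ((p.1.factorial : ℝ) * (p.2.factorial : ℝ)))

end SideRect

/-- A 6-point finite difference scheme at a side point of the left side, for the data `f`, `g₁`:
`∑_{(k,ℓ)} C_{k,ℓ}(h) u(l₁ + k h, y₀ + ℓ h)
   = ∑_{m+n ≤ Kf} f^{(m,n)} C_{f,m,n}(h) + ∑_{n ≤ Kg} g₁^{(n)} C_{g₁,n}(h)`,
with coefficients that are arbitrary functions of the grid size `h`. -/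
structure SixPointScheme where
  C : ℤ × ℤ → ℝ → ℝ
  Kf : ℕ
  Kg : ℕ
  Cf : ℕ → ℕ → ℝ → ℝ
  Cg : ℕ → ℝ → ℝ

namespace SixPointScheme

variable (S : SixPointScheme)

/-- The left-hand side `L_h w`. -/
noncomputable def lhs (D : SideRect) (w : ℝ → ℝ → ℝ) (h : ℝ) : ℝ :=
  ∑ s ∈ stencil, S.C s h * w (D.l₁ + s.1 * h) (D.y₀ + s.2 * h)

/-- The right-hand side. -/
noncomputable def rhs (D : SideRect) (f : ℝ → ℝ → ℝ) (g₁ : ℝ → ℝ) (h : ℝ) : ℝ :=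
  ∑ p ∈ Lam S.Kf, D.pd f p.1 p.2 * S.Cf p.1 p.2 h
    + ∑ n ∈ Finset.range (S.Kg + 1), D.bd g₁ n * S.Cg n h

/-- The left-hand coefficients do not all tend to zero with the grid size. -/
def Nontrivial : Prop := ∃ s ∈ stencil, ¬ Tendsto (S.C s) (𝓝[>] 0) (𝓝 0)

/-- The scheme, in the scaling `h⁻¹ L_h` appropriate for a first-order boundary operator, has a
truncation error `O(h^p)` at every exact solution of smoothness `r`. -/
def HasTruncationOrder (D : SideRect) (a : ℝ → ℝ → ℝ) (α : ℝ → ℝ) (r : ℕ∞) (p : ℕ) : Prop :=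
  ∀ (u f : ℝ → ℝ → ℝ) (g₁ : ℝ → ℝ), D.IsExactSolution a α r u f g₁ →
    (fun h : ℝ => h⁻¹ * (S.lhs D u h - S.rhs D f g₁ h)) =O[𝓝[>] 0] fun h : ℝ => h ^ p

/-- `h⁻¹ L_h` approximates a nonzero multiple of the boundary operator at the side point. -/
def IsConsistent (D : SideRect) (α : ℝ → ℝ) : Prop :=
  ∃ κ : ℝ, κ ≠ 0 ∧ ∀ w : ℝ → ℝ → ℝ, D.SmoothOn 1 w →
    Tendsto (fun h : ℝ => h⁻¹ * S.lhs D w h) (𝓝[>] 0) (𝓝 (κ * D.robin α w D.y₀))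

end SixPointScheme

namespace SideRect

variable (D : SideRect)

/-- The polynomials `C_{k,ℓ}(h) = ∑_{i=0}^6 c_{k,ℓ,i} h^i`. -/
noncomputable def polyC (c : ℤ × ℤ → ℕ → ℝ) (s : ℤ × ℤ) (h : ℝ) : ℝ :=
  ∑ i ∈ Finset.range 7, c s i * h ^ i

/-- The linear system for the coefficients `c_{k,ℓ,i}`: for `n = 0, …, 6`,
`∑_{k,ℓ} C_{k,ℓ}(h) (G_{5,0,n}(kh,ℓh) + ∑_{i=n}^5 (i choose n) α^{(i-n)} G_{5,1,i}(kh,ℓh)) = O(h^7)`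
as `h → 0`. (The inner sum is empty for `n = 6`.) -/
def SolvesSystem (a : ℝ → ℝ → ℝ) (α : ℝ → ℝ) (c : ℤ × ℤ → ℕ → ℝ) : Prop :=
  ∀ n ∈ Finset.range 7,
    (fun h : ℝ => ∑ s ∈ stencil, polyC c s h *
      (D.GV a 5 0 n (s.1 * h) (s.2 * h)
        + ∑ i ∈ Finset.Icc n 5,
            (i.choose n : ℝ) * D.bd α (i - n) * D.GV a 5 1 i (s.1 * h) (s.2 * h)))
      =O[𝓝[>] 0] fun h : ℝ => h ^ 7

/-- The 6-point scheme with the coefficients `C_{k,ℓ}(h) = ∑_i c_{k,ℓ,i} h^i` and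
`C_{f,m,n} = ∑_{k,ℓ} C_{k,ℓ} Q_{5,m,n}(kh,ℓh)` for `m + n ≤ 4`,
`C_{g₁,n} = -∑_{k,ℓ} C_{k,ℓ} G_{5,1,n}(kh,ℓh)` for `n ≤ 5`. -/
noncomputable def robinScheme (a : ℝ → ℝ → ℝ) (c : ℤ × ℤ → ℕ → ℝ) : SixPointScheme where
  C := polyC c
  Kf := 4
  Kg := 5
  Cf := fun m n h => ∑ s ∈ stencil, polyC c s h * D.QV a 5 m n (s.1 * h) (s.2 * h)
  Cg := fun n h => - ∑ s ∈ stencil, polyC c s h * D.GV a 5 1 n (s.1 * h) (s.2 * h)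

end SideRect

/-! The differentiated equation expresses the 6-jet of `u` at P through `u^{(0,n)}`, `u^{(1,n)}` and
the jet of `f`; the differentiated boundary condition gives `u^{(1,n)} = ∑ binom(n,i) α^{(n-i)}
u^{(0,i)} - g₁^{(n)}`. Hence the Taylor polynomial of `u` is `∑ u^{(0,n)} T_n - ∑ g₁^{(n)} G_{1,n} +
∑ f^{(m,n)} Q_{m,n}` (`jetPoly_pd`), where `T_n`, with jet `robinJet`, is the bracket in (*)
(`jetPoly_sysJet`). Thus (*) removes the unknown Dirichlet data up to O(h^7), and the rest is the
right-hand side up to a Taylor remainder.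

Solvability is decided degree by degree. `T_n` starts in degree n with `Re (y + ix)^n / n!`. On the
six stencil points these leading parts, for n ≤ 4, are five independent functionals whose common
kernel is spanned by `leadWeight`, half of the nine-point Laplacian folded across the side. Those
for n = 5, 6 depend on the earlier ones: 120 p₅ = 10 p₃ - (2/3) p₁ and 720 p₆ = 2 p₂. At order zero
`leadWeight` satisfies all seven equations; at the next order n = 5 imposes one compatibility
condition, which holds identically; afterwards only n ≤ 4 occurs (`exists_coeff`). Consistency
follows because the leading coefficients are a multiple of `leadWeight`.

For order seven, the equation for n = 6 also occurs at the next order, and its compatibility defect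
is -(10/7)(2α + (log a)_x) at P (`pair_obstruction`). To reach arbitrary schemes, polynomials with
the jet of `T_n` to high order serve as exact solutions: all data derivatives that the scheme sees
vanish (`exists_testSolution`). A nonzero defect then forces all coefficients to be O(h), even
without assuming boundedness (`not_nontrivial_of_order_seven`). -/

namespace SideRect

variable (D : SideRect)

/-! ### One-sided partial derivatives on the closed rectangle -/

lemma hy : D.l₃ < D.l₄ := D.hy₃.trans D.hy₄

lemma l₁_mem : D.l₁ ∈ Icc D.l₁ D.l₂ := left_mem_Icc.2 D.hx.le

lemma y₀_mem : D.y₀ ∈ Icc D.l₃ D.l₄ := ⟨D.hy₃.le, D.hy₄.le⟩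

lemma base_mem : (D.l₁, D.y₀) ∈ D.OmegaBar := ⟨D.l₁_mem, D.y₀_mem⟩

lemma uniqueDiffX : UniqueDiffOn ℝ (Icc D.l₁ D.l₂) := uniqueDiffOn_Icc D.hx

lemma uniqueDiffY : UniqueDiffOn ℝ (Icc D.l₃ D.l₄) := uniqueDiffOn_Icc D.hy

lemma uniqueDiffOmegaBar : UniqueDiffOn ℝ D.OmegaBar := D.uniqueDiffX.prod D.uniqueDiffY

lemma closure_Omega : closure D.Omega = D.OmegaBar := by
  rw [Omega, closure_prod_eq, closure_Ioo D.hx.ne, closure_Ioo D.hy.ne, OmegaBar]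

lemma interior_OmegaBar : interior D.OmegaBar = D.Omega := by
  rw [OmegaBar, interior_prod_eq, interior_Icc, interior_Icc, Omega]

/-- The partial derivative in `x`, one-sided at the boundary of the rectangle. -/
noncomputable def dx (w : ℝ → ℝ → ℝ) : ℝ → ℝ → ℝ :=
  fun x y => derivWithin (fun s => w s y) (Icc D.l₁ D.l₂) x

/-- The partial derivative in `y`, one-sided at the boundary of the rectangle. -/
noncomputable def dy (w : ℝ → ℝ → ℝ) : ℝ → ℝ → ℝ :=
  fun x y => derivWithin (fun t => w x t) (Icc D.l₃ D.l₄) y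

/-- Equality on the closed rectangle. -/
def EqBar (w v : ℝ → ℝ → ℝ) : Prop :=
  ∀ x ∈ Icc D.l₁ D.l₂, ∀ y ∈ Icc D.l₃ D.l₄, w x y = v x y

variable {D} {w v : ℝ → ℝ → ℝ}

lemma EqBar.dx (h : D.EqBar w v) : D.EqBar (D.dx w) (D.dx v) := fun x hx y hy =>
  derivWithin_congr (fun s hs => h s hs y hy) (h x hx y hy)

lemma EqBar.dy (h : D.EqBar w v) : D.EqBar (D.dy w) (D.dy v) := fun x hx y hy =>
  derivWithin_congr (fun t ht => h x hx t ht) (h x hx y hy)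

lemma EqBar.dx_iterate (h : D.EqBar w v) (m : ℕ) : D.EqBar (D.dx^[m] w) (D.dx^[m] v) := by
  induction m generalizing w v with
  | zero => exact h
  | succ m ih => exact ih h.dx

lemma EqBar.dy_iterate (h : D.EqBar w v) (n : ℕ) : D.EqBar (D.dy^[n] w) (D.dy^[n] v) := by
  induction n generalizing w v with
  | zero => exact h
  | succ m ih => exact ih h.dy

lemma EqBar.trans {z : ℝ → ℝ → ℝ} (h : D.EqBar w v) (h' : D.EqBar v z) : D.EqBar w z :=
  fun x hx y hy => (h x hx y hy).trans (h' x hx y hy)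

lemma SmoothOn.of_le {r s : ℕ∞} (h : D.SmoothOn r w) (hs : s ≤ r) : D.SmoothOn s w :=
  ContDiffOn.of_le h (by exact_mod_cast hs)

lemma SmoothOn.add {r : ℕ∞} (h : D.SmoothOn r w) (h' : D.SmoothOn r v) :
    D.SmoothOn r (fun x y => w x y + v x y) := ContDiffOn.add h h'

lemma SmoothOn.mul {r : ℕ∞} (h : D.SmoothOn r w) (h' : D.SmoothOn r v) :
    D.SmoothOn r (fun x y => w x y * v x y) := ContDiffOn.mul h h'

lemma SmoothOn.neg {r : ℕ∞} (h : D.SmoothOn r w) :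
    D.SmoothOn r (fun x y => - w x y) := ContDiffOn.neg h

lemma SmoothOn.slice_x {r : ℕ∞} (h : D.SmoothOn r w) {y : ℝ} (hy : y ∈ Icc D.l₃ D.l₄) :
    ContDiffOn ℝ r (fun x => w x y) (Icc D.l₁ D.l₂) :=
  ContDiffOn.comp h (t := D.OmegaBar) (g := fun z : ℝ × ℝ => w z.1 z.2) (f := fun x => (x, y))
    (by fun_prop) fun _ hx => ⟨hx, hy⟩

lemma SmoothOn.slice_y {r : ℕ∞} (h : D.SmoothOn r w) {x : ℝ} (hx : x ∈ Icc D.l₁ D.l₂) :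
    ContDiffOn ℝ r (fun y => w x y) (Icc D.l₃ D.l₄) :=
  ContDiffOn.comp h (t := D.OmegaBar) (g := fun z : ℝ × ℝ => w z.1 z.2) (f := fun y => (x, y))
    (by fun_prop) fun _ hy => ⟨hx, hy⟩

lemma SmoothOn.hasFDerivWithinAt (h : D.SmoothOn 1 w) {z : ℝ × ℝ} (hz : z ∈ D.OmegaBar) :
    HasFDerivWithinAt (fun z : ℝ × ℝ => w z.1 z.2)
      (fderivWithin ℝ (fun z : ℝ × ℝ => w z.1 z.2) D.OmegaBar z) D.OmegaBar z :=
  ((ContDiffOn.differentiableOn h (by simp)) z hz).hasFDerivWithinAt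

lemma dx_eq (h : D.SmoothOn 1 w) {z : ℝ × ℝ} (hz : z ∈ D.OmegaBar) :
    D.dx w z.1 z.2 = fderivWithin ℝ (fun z : ℝ × ℝ => w z.1 z.2) D.OmegaBar z (1, 0) := by
  have := (h.hasFDerivWithinAt hz).comp_hasDerivWithinAt (f := fun s : ℝ => (s, z.2))
    (s := Icc D.l₁ D.l₂) z.1
    ((hasDerivWithinAt_id z.1 _).prodMk (hasDerivWithinAt_const z.1 _ z.2))
    fun s hs => ⟨hs, hz.2⟩
  exact this.derivWithin (D.uniqueDiffX z.1 hz.1)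

lemma dy_eq (h : D.SmoothOn 1 w) {z : ℝ × ℝ} (hz : z ∈ D.OmegaBar) :
    D.dy w z.1 z.2 = fderivWithin ℝ (fun z : ℝ × ℝ => w z.1 z.2) D.OmegaBar z (0, 1) := by
  have := (h.hasFDerivWithinAt hz).comp_hasDerivWithinAt (f := fun s : ℝ => (z.1, s))
    (s := Icc D.l₃ D.l₄) z.2
    ((hasDerivWithinAt_const z.2 _ z.1).prodMk (hasDerivWithinAt_id z.2 _))
    fun s hs => ⟨hz.1, hs⟩
  exact this.derivWithin (D.uniqueDiffY z.2 hz.2)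

lemma SmoothOn.fderivWithin {r : ℕ∞} (h : D.SmoothOn (r + 1) w) :
    ContDiffOn ℝ r (fderivWithin ℝ (fun z : ℝ × ℝ => w z.1 z.2) D.OmegaBar) D.OmegaBar :=
  ContDiffOn.fderivWithin h D.uniqueDiffOmegaBar (by simp)

lemma SmoothOn.dx {r : ℕ∞} (h : D.SmoothOn (r + 1) w) : D.SmoothOn r (D.dx w) :=
  (h.fderivWithin.clm_apply (contDiffOn_const (c := ((1 : ℝ), (0 : ℝ))))).congr
    fun _ hz => dx_eq (h.of_le (by simp)) hz

lemma SmoothOn.dy {r : ℕ∞} (h : D.SmoothOn (r + 1) w) : D.SmoothOn r (D.dy w) :=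
  (h.fderivWithin.clm_apply (contDiffOn_const (c := ((0 : ℝ), (1 : ℝ))))).congr
    fun _ hz => dy_eq (h.of_le (by simp)) hz

lemma SmoothOn.dy_iterate {r : ℕ∞} {n : ℕ} (h : D.SmoothOn (r + n) w) :
    D.SmoothOn r (D.dy^[n] w) := by
  induction n generalizing w with
  | zero => simpa using h
  | succ n ih =>
    refine ih (SmoothOn.dy (h.of_le (le_of_eq ?_)))
    push_cast; ring

/-- Symmetry of the second derivative persists at boundary points because the closed rectangle is
the closure of its interior. -/
lemma dx_dy_comm (h : D.SmoothOn 2 w) : D.EqBar (D.dx (D.dy w)) (D.dy (D.dx w)) := by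
  intro x hx y hy
  have hz : (x, y) ∈ D.OmegaBar := ⟨hx, hy⟩
  have h1 : D.SmoothOn 1 w := h.of_le (by norm_num)
  have h2 : D.SmoothOn (1 + 1) w := h.of_le (by norm_num)
  have hF : HasFDerivWithinAt (_root_.fderivWithin ℝ (fun z : ℝ × ℝ => w z.1 z.2) D.OmegaBar)
      (_root_.fderivWithin ℝ (_root_.fderivWithin ℝ (fun z : ℝ × ℝ => w z.1 z.2) D.OmegaBar)
        D.OmegaBar (x, y)) D.OmegaBar (x, y) :=
    ((h2.fderivWithin.differentiableOn (by simp)) (x, y) hz).hasFDerivWithinAt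
  have key : ∀ e : ℝ × ℝ, _root_.fderivWithin ℝ (fun z : ℝ × ℝ =>
      _root_.fderivWithin ℝ (fun z : ℝ × ℝ => w z.1 z.2) D.OmegaBar z e) D.OmegaBar (x, y) =
      (_root_.fderivWithin ℝ (_root_.fderivWithin ℝ (fun z : ℝ × ℝ => w z.1 z.2) D.OmegaBar)
        D.OmegaBar (x, y)).flip e := fun e =>
    (((ContinuousLinearMap.apply ℝ ℝ e).hasFDerivAt.comp_hasFDerivWithinAt (x, y) hF).fderivWithin
      (D.uniqueDiffOmegaBar _ hz)).trans (by ext <;> simp)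
  have hs : IsSymmSndFDerivWithinAt ℝ (fun z : ℝ × ℝ => w z.1 z.2) D.OmegaBar (x, y) :=
    ContDiffWithinAt.isSymmSndFDerivWithinAt (h (x, y) hz) (by simp) D.uniqueDiffOmegaBar
      (by rw [interior_OmegaBar, closure_Omega]; exact hz) hz
  have ex := dx_eq (w := D.dy w) h2.dy hz
  have ey := dy_eq (w := D.dx w) h2.dx hz
  dsimp only at ex ey
  rw [ex, ey, fderivWithin_congr (fun z hz => dy_eq h1 hz) (dy_eq h1 hz),
    fderivWithin_congr (fun z hz => dx_eq h1 hz) (dx_eq h1 hz), key, key]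
  simpa using hs _ _

/-- `pd` differentiates in y first. Moving `dx` past the y-derivatives is what allows the jet of `dx
w` to be read off as a shifted jet of `w`. -/
lemma dy_iterate_dx_comm {n : ℕ} (h : D.SmoothOn (n + 1) w) :
    D.EqBar (D.dy^[n] (D.dx w)) (D.dx (D.dy^[n] w)) := by
  induction n generalizing w with
  | zero => exact fun _ _ _ _ => rfl
  | succ n ih =>
    have h2 : D.SmoothOn 2 w := h.of_le (by
      have : ((1 : ℕ) : ℕ∞) ≤ ((n + 1 : ℕ) : ℕ∞) := by exact_mod_cast Nat.le_add_left 1 n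
      calc (2 : ℕ∞) = ((1 : ℕ) : ℕ∞) + 1 := by norm_num
        _ ≤ _ := by gcongr)
    have h3 : D.SmoothOn (n + 1) (D.dy w) := SmoothOn.dy (h.of_le (by push_cast; rfl))
    refine EqBar.trans ?_ (ih h3)
    exact EqBar.dy_iterate (fun x hx y hy => (dx_dy_comm h2 x hx y hy).symm) n

lemma dx_iterate_eq (w : ℝ → ℝ → ℝ) (m : ℕ) (x y : ℝ) :
    (D.dx^[m] w) x y = iteratedDerivWithin m (fun x => w x y) (Icc D.l₁ D.l₂) x := by
  induction m generalizing x with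
  | zero => simp
  | succ m ih =>
    rw [iteratedDerivWithin_succ, Function.iterate_succ_apply']
    simp only [SideRect.dx]
    congr 1
    ext t; exact ih t

lemma dy_iterate_eq (w : ℝ → ℝ → ℝ) (n : ℕ) (x y : ℝ) :
    (D.dy^[n] w) x y = iteratedDerivWithin n (fun y => w x y) (Icc D.l₃ D.l₄) y := by
  induction n generalizing y with
  | zero => simp
  | succ n ih =>
    rw [iteratedDerivWithin_succ, Function.iterate_succ_apply']
    simp only [SideRect.dy]
    congr 1
    ext t; exact ih t

lemma pd_eq_iteratedDerivWithin (w : ℝ → ℝ → ℝ) (m n : ℕ) :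
    D.pd w m n = iteratedDerivWithin m (fun x => (D.dy^[n] w) x D.y₀) (Icc D.l₁ D.l₂) D.l₁ := by
  simp only [pd, dy_iterate_eq]

lemma pd_eq (w : ℝ → ℝ → ℝ) (m n : ℕ) : D.pd w m n = (D.dx^[m] (D.dy^[n] w)) D.l₁ D.y₀ := by
  rw [pd_eq_iteratedDerivWithin, dx_iterate_eq]

lemma pd_zero_zero (w : ℝ → ℝ → ℝ) : D.pd w 0 0 = w D.l₁ D.y₀ := by simp [pd_eq]

lemma pd_congr (h : D.EqBar w v) (m n : ℕ) : D.pd w m n = D.pd v m n := by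
  rw [pd_eq, pd_eq]
  exact (h.dy_iterate n).dx_iterate m _ D.l₁_mem _ D.y₀_mem

lemma pd_dy (w : ℝ → ℝ → ℝ) (m n : ℕ) : D.pd (D.dy w) m n = D.pd w m (n + 1) := by
  simp [pd_eq]

lemma pd_dx {n : ℕ} (h : D.SmoothOn (n + 1) w) (m : ℕ) :
    D.pd (D.dx w) m n = D.pd w (m + 1) n := by
  rw [pd_eq, pd_eq, Function.iterate_succ_apply]
  exact (dy_iterate_dx_comm h).dx_iterate m _ D.l₁_mem _ D.y₀_mem

end SideRect

/-! ### Jets of sums, products and monomials -/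

namespace SideRect

variable {D : SideRect} {w v : ℝ → ℝ → ℝ}

lemma SmoothOn.slice_dy {m n : ℕ} (h : D.SmoothOn (m + n : ℕ) w) :
    ContDiffOn ℝ m (fun x => (D.dy^[n] w) x D.y₀) (Icc D.l₁ D.l₂) :=
  SmoothOn.slice_x (r := m) (SmoothOn.dy_iterate (h.of_le (by push_cast; rfl))) D.y₀_mem

lemma pd_add {m n : ℕ} (hw : D.SmoothOn (m + n : ℕ) w) (hv : D.SmoothOn (m + n : ℕ) v) :
    D.pd (fun x y => w x y + v x y) m n = D.pd w m n + D.pd v m n := by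
  have hY : EqOn (fun x => (D.dy^[n] (fun x y => w x y + v x y)) x D.y₀)
      (fun x => (D.dy^[n] w) x D.y₀ + (D.dy^[n] v) x D.y₀) (Icc D.l₁ D.l₂) := by
    intro x hx
    simp only [dy_iterate_eq]
    exact iteratedDerivWithin_fun_add D.y₀_mem D.uniqueDiffY
      (((hw.of_le (by exact_mod_cast Nat.le_add_left n m)).slice_y hx) _ D.y₀_mem)
      (((hv.of_le (by exact_mod_cast Nat.le_add_left n m)).slice_y hx) _ D.y₀_mem)
  simp only [pd_eq_iteratedDerivWithin]
  rw [iteratedDerivWithin_congr hY D.l₁_mem]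
  exact iteratedDerivWithin_fun_add D.l₁_mem D.uniqueDiffX
    (hw.slice_dy _ D.l₁_mem) (hv.slice_dy _ D.l₁_mem)

lemma pd_neg (w : ℝ → ℝ → ℝ) (m n : ℕ) :
    D.pd (fun x y => - w x y) m n = - D.pd w m n := by
  simp only [pd, iteratedDerivWithin_fun_neg]

/-- The one-variable Leibniz rule is used twice: in y on every slice, then in x on each resulting
product. -/
lemma pd_mul {m n : ℕ} (hw : D.SmoothOn (m + n : ℕ) w) (hv : D.SmoothOn (m + n : ℕ) v) :
    D.pd (fun x y => w x y * v x y) m n =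
      ∑ i ∈ Finset.range (m + 1), ∑ j ∈ Finset.range (n + 1),
        ((m.choose i : ℝ) * (n.choose j : ℝ)) * (D.pd w i j * D.pd v (m - i) (n - j)) := by
  have hY : EqOn (fun x => (D.dy^[n] (fun x y => w x y * v x y)) x D.y₀)
      (fun x => ∑ j ∈ Finset.range (n + 1),
        (n.choose j : ℝ) * ((D.dy^[j] w) x D.y₀ * (D.dy^[n - j] v) x D.y₀))
      (Icc D.l₁ D.l₂) := by
    intro x hx
    simp only [dy_iterate_eq]
    refine (iteratedDerivWithin_mul D.y₀_mem D.uniqueDiffY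
      (((hw.of_le (by exact_mod_cast Nat.le_add_left n m)).slice_y hx) _ D.y₀_mem)
      (((hv.of_le (by exact_mod_cast Nat.le_add_left n m)).slice_y hx) _ D.y₀_mem)).trans ?_
    simp only [mul_assoc]
  have hw' : ∀ j ∈ Finset.range (n + 1),
      ContDiffWithinAt ℝ m (fun x => (D.dy^[j] w) x D.y₀) (Icc D.l₁ D.l₂) D.l₁ := fun j hj =>
    (hw.of_le (s := (m + j : ℕ)) (by
      have := Finset.mem_range.1 hj; exact_mod_cast (by omega))).slice_dy _ D.l₁_mem
  have hv' : ∀ j ∈ Finset.range (n + 1),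
      ContDiffWithinAt ℝ m (fun x => (D.dy^[n - j] v) x D.y₀) (Icc D.l₁ D.l₂) D.l₁ := fun j hj =>
    (hv.of_le (s := (m + (n - j) : ℕ)) (by
      exact_mod_cast (by omega))).slice_dy _ D.l₁_mem
  rw [pd_eq_iteratedDerivWithin, iteratedDerivWithin_congr hY D.l₁_mem,
    iteratedDerivWithin_fun_sum D.l₁_mem D.uniqueDiffX
      fun j hj => contDiffWithinAt_const.mul ((hw' j hj).mul (hv' j hj)), Finset.sum_comm]
  refine Finset.sum_congr rfl fun j hj => ?_
  rw [iteratedDerivWithin_const_mul_field]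
  have := iteratedDerivWithin_mul D.l₁_mem D.uniqueDiffX (hw' j hj) (hv' j hj)
  rw [show (fun x => (D.dy^[j] w) x D.y₀ * (D.dy^[n - j] v) x D.y₀) =
    (fun x => (D.dy^[j] w) x D.y₀) * (fun x => (D.dy^[n - j] v) x D.y₀) from rfl, this,
    Finset.mul_sum]
  refine Finset.sum_congr rfl fun i _ => ?_
  rw [pd_eq_iteratedDerivWithin, pd_eq_iteratedDerivWithin]
  ring

lemma SmoothOn.sum {ι : Type*} (s : Finset ι) {W : ι → ℝ → ℝ → ℝ} {r : ℕ∞}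
    (h : ∀ i ∈ s, D.SmoothOn r (W i)) : D.SmoothOn r (fun x y => ∑ i ∈ s, W i x y) :=
  ContDiffOn.sum (f := fun i (z : ℝ × ℝ) => W i z.1 z.2) h

lemma pd_sum {ι : Type*} (s : Finset ι) {W : ι → ℝ → ℝ → ℝ} {m n : ℕ}
    (h : ∀ i ∈ s, D.SmoothOn (m + n : ℕ) (W i)) :
    D.pd (fun x y => ∑ i ∈ s, W i x y) m n = ∑ i ∈ s, D.pd (W i) m n := by
  classical
  induction s using Finset.induction_on with
  | empty => simp [pd]
  | insert i s hi ih =>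
    simp only [Finset.sum_insert hi]
    rw [pd_add (h i (Finset.mem_insert_self i s))
      (SmoothOn.sum s fun j hj => h j (Finset.mem_insert_of_mem hj)),
      ih fun j hj => h j (Finset.mem_insert_of_mem hj)]

lemma pd_const_mul (c : ℝ) (w : ℝ → ℝ → ℝ) (m n : ℕ) :
    D.pd (fun x y => c * w x y) m n = c * D.pd w m n := by
  simp only [pd, iteratedDerivWithin_const_mul_field]

/-- The jet of the divided monomial `(x - l₁)^a (y - y₀)^b / (a! b!)`. -/
lemma pd_monomial (a b m n : ℕ) :
    D.pd (fun x y => (x - D.l₁) ^ a * (y - D.y₀) ^ b / ((a.factorial : ℝ) * (b.factorial : ℝ))) m n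
      = kron a b m n := by
  have key : ∀ (s : Set ℝ) (c : ℝ) (k i : ℕ), UniqueDiffOn ℝ s → c ∈ s →
      iteratedDerivWithin i (fun x => (x - c) ^ k) s c = if i = k then (k.factorial : ℝ) else 0 := by
    intro s c k i hs hc
    rw [iteratedDerivWithin_eq_iteratedDeriv hs (by fun_prop) hc,
      iteratedDeriv_comp_sub_const i (fun x : ℝ => x ^ k) c]
    simpa using iteratedDeriv_fun_pow_zero (𝕜 := ℝ) (n := i) (m := k)
  have e : ∀ x y : ℝ, (x - D.l₁) ^ a * (y - D.y₀) ^ b / ((a.factorial : ℝ) * (b.factorial : ℝ))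
      = ((x - D.l₁) ^ a / ((a.factorial : ℝ) * (b.factorial : ℝ))) * (y - D.y₀) ^ b := by
    intro x y; ring
  have ha : (a.factorial : ℝ) ≠ 0 := by positivity
  have hb : (b.factorial : ℝ) ≠ 0 := by positivity
  simp only [pd, e, iteratedDerivWithin_const_mul_field, key _ _ _ _ D.uniqueDiffY D.y₀_mem,
    div_eq_mul_inv, iteratedDerivWithin_mul_const_field, key _ _ _ _ D.uniqueDiffX D.l₁_mem]
  by_cases h1 : m = a <;> by_cases h2 : n = b <;> simp [kron, h1, h2]
  field_simp

end SideRect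

/-! ### Taylor polynomials and their homogeneous parts -/

/-- The homogeneous part of degree `d` of the Taylor polynomial with the jet `J`. -/
noncomputable def homogPart (J : ℕ → ℕ → ℝ) (d : ℕ) (x y : ℝ) : ℝ :=
  ∑ p ∈ Finset.HasAntidiagonal.antidiagonal d,
    J p.1 p.2 * (x ^ p.1 * y ^ p.2 / ((p.1.factorial : ℝ) * (p.2.factorial : ℝ)))

/-- The Taylor polynomial of degree `N` with the jet `J`. -/
noncomputable def jetPoly (J : ℕ → ℕ → ℝ) (N : ℕ) (x y : ℝ) : ℝ :=
  ∑ p ∈ Lam N,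
    J p.1 p.2 * (x ^ p.1 * y ^ p.2 / ((p.1.factorial : ℝ) * (p.2.factorial : ℝ)))

lemma mem_Lam {K : ℕ} {p : ℕ × ℕ} : p ∈ Lam K ↔ p.1 + p.2 ≤ K := by
  simp only [Lam, Finset.mem_filter, Finset.mem_product, Finset.mem_range]
  omega

lemma jetPoly_eq_sum (J : ℕ → ℕ → ℝ) (N : ℕ) (x y : ℝ) :
    jetPoly J N x y = ∑ d ∈ Finset.range (N + 1), homogPart J d x y := by
  rw [jetPoly, ← Finset.sum_fiberwise_of_maps_to (s := Lam N) (t := Finset.range (N + 1))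
    (g := fun p => p.1 + p.2) (fun p hp => Finset.mem_range.2 (by have := mem_Lam.1 hp; omega))]
  refine Finset.sum_congr rfl fun d hd => ?_
  refine Finset.sum_congr ?_ fun _ _ => rfl
  ext p
  have := Finset.mem_range.1 hd
  simp only [Finset.mem_filter, mem_Lam, Finset.HasAntidiagonal.mem_antidiagonal]
  omega

lemma homogPart_smul (J : ℕ → ℕ → ℝ) (d : ℕ) (x y h : ℝ) :
    homogPart J d (x * h) (y * h) = h ^ d * homogPart J d x y := by
  rw [homogPart, homogPart, Finset.mul_sum]
  refine Finset.sum_congr rfl fun p hp => ?_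
  rw [← Finset.HasAntidiagonal.mem_antidiagonal.1 hp]
  ring

/-! ### Taylor expansion along the rays of the stencil -/

namespace SideRect

variable {D : SideRect} {w v : ℝ → ℝ → ℝ}

/-- The segment `t ↦ P + t (k, l)`, `0 ≤ t ≤ b`, lies in the closed rectangle. -/
def RayIn (D : SideRect) (k l b : ℝ) : Prop :=
  ∀ t ∈ Icc 0 b, D.l₁ + k * t ∈ Icc D.l₁ D.l₂ ∧ D.y₀ + l * t ∈ Icc D.l₃ D.l₄

lemma exists_rayIn {s : ℤ × ℤ} (hs : s ∈ stencil) : ∃ b > 0, D.RayIn s.1 s.2 b := by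
  refine ⟨min (D.l₂ - D.l₁) (min (D.y₀ - D.l₃) (D.l₄ - D.y₀)), lt_min (sub_pos.2 D.hx)
    (lt_min (sub_pos.2 D.hy₃) (sub_pos.2 D.hy₄)), fun t ht => ?_⟩
  have h1 := ht.2.trans (min_le_left _ _)
  have h2 := ht.2.trans ((min_le_right _ _).trans (min_le_left _ _))
  have h3 := ht.2.trans ((min_le_right _ _).trans (min_le_right _ _))
  have h4 := D.hx
  have h5 := D.hy₃
  have h6 := D.hy₄
  have h0 := ht.1
  simp only [stencil, Finset.mem_product, Finset.mem_insert, Finset.mem_singleton] at hs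
  obtain ⟨hk, hl⟩ := hs
  constructor
  · rcases hk with hk | hk <;> simp only [hk, mem_Icc] <;> constructor <;> push_cast <;> linarith
  · rcases hl with hl | hl | hl <;> simp only [hl, mem_Icc] <;> constructor <;> push_cast <;>
      linarith

variable {k l b : ℝ}

lemma SmoothOn.ray {r : ℕ∞} (hw : D.SmoothOn r w) (hr : D.RayIn k l b) :
    ContDiffOn ℝ r (fun t => w (D.l₁ + k * t) (D.y₀ + l * t)) (Icc 0 b) :=
  ContDiffOn.comp hw (t := D.OmegaBar) (g := fun z : ℝ × ℝ => w z.1 z.2)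
    (f := fun t => (D.l₁ + k * t, D.y₀ + l * t)) (by fun_prop) hr

lemma SmoothOn.hasDerivWithinAt_ray (hw : D.SmoothOn 1 w) (hr : D.RayIn k l b) {t : ℝ}
    (ht : t ∈ Icc 0 b) :
    HasDerivWithinAt (fun t => w (D.l₁ + k * t) (D.y₀ + l * t))
      (k * D.dx w (D.l₁ + k * t) (D.y₀ + l * t) + l * D.dy w (D.l₁ + k * t) (D.y₀ + l * t))
      (Icc 0 b) t := by
  have hz : (D.l₁ + k * t, D.y₀ + l * t) ∈ D.OmegaBar := hr t ht
  have h1 : HasDerivWithinAt (fun t : ℝ => (D.l₁ + k * t, D.y₀ + l * t)) (k, l) (Icc 0 b) t := by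
    simpa using (((hasDerivWithinAt_id t _).const_mul k).const_add D.l₁).prodMk
      (((hasDerivWithinAt_id t _).const_mul l).const_add D.y₀)
  have := (hw.hasFDerivWithinAt hz).comp_hasDerivWithinAt t h1 fun t ht => hr t ht
  have ex := dx_eq hw hz
  have ey := dy_eq hw hz
  dsimp only at ex ey
  rw [ex, ey]
  rw [show ((k, l) : ℝ × ℝ) = k • (1, 0) + l • (0, 1) by simp, map_add, map_smul, map_smul] at this
  exact this

/-- Along the ray the derivative is `k ∂_x + l ∂_y`, with constant coefficients; since the partial
derivatives commute, its powers expand binomially by Pascal's rule. -/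
lemma iteratedDerivWithin_ray {j : ℕ} (hw : D.SmoothOn j w) (hr : D.RayIn k l b) (hb : 0 < b) :
    iteratedDerivWithin j (fun t => w (D.l₁ + k * t) (D.y₀ + l * t)) (Icc 0 b) 0
      = ∑ p ∈ Finset.HasAntidiagonal.antidiagonal j,
        (j.choose p.1 : ℝ) * (k ^ p.1 * l ^ p.2 * D.pd w p.1 p.2) := by
  have h0 : (0 : ℝ) ∈ Icc 0 b := left_mem_Icc.2 hb.le
  have hu := uniqueDiffOn_Icc hb
  induction j generalizing w with
  | zero => simp [pd_zero_zero]
  | succ j ih =>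
    have h1 : D.SmoothOn 1 w := hw.of_le (by exact_mod_cast Nat.le_add_left 1 j)
    have hx : D.SmoothOn j (D.dx w) := SmoothOn.dx (hw.of_le (by push_cast; rfl))
    have hy : D.SmoothOn j (D.dy w) := SmoothOn.dy (hw.of_le (by push_cast; rfl))
    have e : EqOn (derivWithin (fun t => w (D.l₁ + k * t) (D.y₀ + l * t)) (Icc 0 b))
        (fun t => k * D.dx w (D.l₁ + k * t) (D.y₀ + l * t)
          + l * D.dy w (D.l₁ + k * t) (D.y₀ + l * t)) (Icc 0 b) := fun t ht =>
      (h1.hasDerivWithinAt_ray hr ht).derivWithin (hu t ht)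
    rw [iteratedDerivWithin_succ', iteratedDerivWithin_congr e h0, iteratedDerivWithin_fun_add h0 hu
      (contDiffWithinAt_const.mul (hx.ray hr 0 h0)) (contDiffWithinAt_const.mul (hy.ray hr 0 h0)),
      iteratedDerivWithin_const_mul_field, iteratedDerivWithin_const_mul_field, ih hx, ih hy,
      Finset.sum_antidiagonal_choose_succ_mul (fun p q => k ^ p * l ^ q * D.pd w p q), add_comm,
      Finset.mul_sum, Finset.mul_sum]
    congr 1
    · refine Finset.sum_congr rfl fun p _ => ?_
      rw [pd_dy]; ring
    · refine Finset.sum_congr rfl fun p hp => ?_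
      have hp' := Finset.HasAntidiagonal.mem_antidiagonal.1 hp
      rw [pd_dx (hw.of_le (by exact_mod_cast (by omega))), Nat.choose_symm_of_eq_add hp'.symm]
      ring

/-- Each stencil point moves along a segment issuing from P that stays in the closed rectangle for
small h, so the one-variable Taylor bound suffices; the binomial coefficients turn its j-th term
into the homogeneous part of degree j. -/
lemma taylor_ray {N : ℕ} (hw : D.SmoothOn (N + 1 : ℕ) w) {s : ℤ × ℤ} (hs : s ∈ stencil) :
    (fun h : ℝ => w (D.l₁ + s.1 * h) (D.y₀ + s.2 * h) - jetPoly (D.pd w) N (s.1 * h) (s.2 * h))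
      =O[𝓝[>] 0] fun h : ℝ => h ^ (N + 1) := by
  obtain ⟨b, hb, hr⟩ := exists_rayIn (D := D) hs
  obtain ⟨C, hC⟩ := exists_taylor_mean_remainder_bound (n := N) hb.le
    (f := fun t => w (D.l₁ + s.1 * t) (D.y₀ + s.2 * t))
    ((hw.ray hr).of_le (by push_cast; rfl))
  have hP : ∀ h : ℝ, taylorWithinEval (fun t => w (D.l₁ + s.1 * t) (D.y₀ + s.2 * t)) N (Icc 0 b) 0 h
      = jetPoly (D.pd w) N (s.1 * h) (s.2 * h) := by
    intro h
    rw [taylor_within_apply, jetPoly_eq_sum]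
    refine Finset.sum_congr rfl fun d hd => ?_
    rw [homogPart_smul, iteratedDerivWithin_ray (hw.of_le (by
      have := Finset.mem_range.1 hd; exact_mod_cast (by omega))) hr hb, smul_eq_mul, homogPart,
      mul_comm ((d.factorial : ℝ)⁻¹), sub_zero, mul_assoc]
    congr 1
    rw [Finset.mul_sum]
    refine Finset.sum_congr rfl fun p hp => ?_
    have hp' := Finset.HasAntidiagonal.mem_antidiagonal.1 hp
    have h3 : (d.choose p.1 : ℝ) * p.1.factorial * p.2.factorial = d.factorial := by
      rw [← hp', Nat.choose_symm_add]; exact_mod_cast Nat.add_choose_mul_factorial_mul_factorial p.1 p.2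
    have h4 : (p.1.factorial : ℝ) ≠ 0 := by positivity
    have h5 : (p.2.factorial : ℝ) ≠ 0 := by positivity
    have h6 : (d.factorial : ℝ) ≠ 0 := by positivity
    field_simp
    rw [← h3]; ring
  refine IsBigO.of_bound C ?_
  filter_upwards [Ioc_mem_nhdsGT hb] with h hh
  have := hC h ⟨hh.1.le, hh.2⟩
  rw [hP, sub_zero] at this
  rwa [Real.norm_of_nonneg (pow_nonneg hh.1.le _)]

/-! ### The differential equation up to the boundary -/

lemma hasDerivAt_dx (hw : D.SmoothOn 1 w) {x y : ℝ} (hx : x ∈ Ioo D.l₁ D.l₂)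
    (hy : y ∈ Icc D.l₃ D.l₄) : HasDerivAt (fun s => w s y) (D.dx w x y) x :=
  (((hw.slice_x hy).differentiableOn (by simp) x
    (Ioo_subset_Icc_self hx)).hasDerivWithinAt).hasDerivAt (Icc_mem_nhds hx.1 hx.2)

lemma hasDerivAt_dy (hw : D.SmoothOn 1 w) {x y : ℝ} (hx : x ∈ Icc D.l₁ D.l₂)
    (hy : y ∈ Ioo D.l₃ D.l₄) : HasDerivAt (fun t => w x t) (D.dy w x y) y :=
  (((hw.slice_y hx).differentiableOn (by simp) y
    (Ioo_subset_Icc_self hy)).hasDerivWithinAt).hasDerivAt (Icc_mem_nhds hy.1 hy.2)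

variable {a u f : ℝ → ℝ → ℝ}

/-- `-∇·(a∇u)` in nondivergence form, on the closed rectangle. -/
noncomputable def negDivGrad (D : SideRect) (a u : ℝ → ℝ → ℝ) (x y : ℝ) : ℝ :=
  - (D.dx a x y * D.dx u x y + a x y * D.dx (D.dx u) x y
    + (D.dy a x y * D.dy u x y + a x y * D.dy (D.dy u) x y))

lemma negDivGrad_eq (ha : D.SmoothOn 1 a) (hu : D.SmoothOn 2 u) {x y : ℝ}
    (hx : x ∈ Ioo D.l₁ D.l₂) (hy : y ∈ Ioo D.l₃ D.l₄) :
    - (deriv (fun s => a s y * deriv (fun t => u t y) s) x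
        + deriv (fun s => a x s * deriv (fun t => u x t) s) y) = D.negDivGrad a u x y := by
  have hx' := Ioo_subset_Icc_self hx
  have hy' := Ioo_subset_Icc_self hy
  have hu1 : D.SmoothOn 1 u := hu.of_le (by norm_num)
  have hu2 : D.SmoothOn (1 + 1) u := hu.of_le (by norm_num)
  have e1 : (fun s => a s y * deriv (fun t => u t y) s) =ᶠ[𝓝 x] fun s => a s y * D.dx u s y := by
    filter_upwards [Ioo_mem_nhds hx.1 hx.2] with s hs
    rw [(hasDerivAt_dx hu1 hs hy').deriv]
  have e2 : (fun s => a x s * deriv (fun t => u x t) s) =ᶠ[𝓝 y] fun s => a x s * D.dy u x s := by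
    filter_upwards [Ioo_mem_nhds hy.1 hy.2] with s hs
    rw [(hasDerivAt_dy hu1 hx' hs).deriv]
  rw [e1.deriv_eq, e2.deriv_eq, negDivGrad,
    ((hasDerivAt_dx ha hx hy').fun_mul (hasDerivAt_dx hu2.dx hx hy')).deriv,
    ((hasDerivAt_dy ha hx' hy).fun_mul (hasDerivAt_dy hu2.dy hx' hy)).deriv]

lemma SmoothOn.negDivGrad {r : ℕ∞} (ha : D.SmoothOn (r + 1) a) (hu : D.SmoothOn (r + 1 + 1) u) :
    D.SmoothOn r (D.negDivGrad a u) := by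
  have hu' : D.SmoothOn (r + 1) u := hu.of_le (by simp)
  have ha' : D.SmoothOn r a := ha.of_le (by simp)
  exact (((ha.dx.mul hu'.dx).add (ha'.mul hu.dx.dx)).add
    ((ha.dy.mul hu'.dy).add (ha'.mul hu.dy.dy))).neg

/-- The equation is posed only in the open rectangle. Both sides are continuous up to the boundary,
so it extends by density and can be differentiated at P. -/
lemma negDivGrad_eqBar (ha : D.SmoothOn 1 a) (hu : D.SmoothOn 2 u) (hf : D.SmoothOn 0 f)
    (h : ∀ x ∈ Ioo D.l₁ D.l₂, ∀ y ∈ Ioo D.l₃ D.l₄,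
    - (deriv (fun s => a s y * deriv (fun t => u t y) s) x
        + deriv (fun s => a x s * deriv (fun t => u x t) s) y) = f x y) :
    D.EqBar (D.negDivGrad a u) f := by
  have hc : D.SmoothOn 0 (D.negDivGrad a u) :=
    SmoothOn.negDivGrad (ha.of_le (by norm_num)) (hu.of_le (by norm_num))
  have key : EqOn (fun z : ℝ × ℝ => D.negDivGrad a u z.1 z.2) (fun z => f z.1 z.2) D.OmegaBar := by
    refine EqOn.of_subset_closure (s := D.Omega) (fun z hz => ?_) (ContDiffOn.continuousOn hc)
      (ContDiffOn.continuousOn hf) ?_ D.closure_Omega.ge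
    · rw [← negDivGrad_eq ha hu hz.1 hz.2, h _ hz.1 _ hz.2]
    · rw [← D.closure_Omega]; exact subset_closure
  exact fun x hx y hy => key (x := (x, y)) ⟨hx, hy⟩

lemma SmoothOn.log {r : ℕ∞} (ha : D.SmoothOn r a) (hpos : ∀ z ∈ D.OmegaBar, 0 < a z.1 z.2) :
    D.SmoothOn r (fun x y => Real.log (a x y)) :=
  ContDiffOn.log ha fun z hz => (hpos z hz).ne'

lemma SmoothOn.inv {r : ℕ∞} (ha : D.SmoothOn r a) (hpos : ∀ z ∈ D.OmegaBar, 0 < a z.1 z.2) :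
    D.SmoothOn r (fun x y => (a x y)⁻¹) :=
  ContDiffOn.inv ha fun z hz => (hpos z hz).ne'

lemma dx_log (ha : D.SmoothOn 1 a) (hpos : ∀ z ∈ D.OmegaBar, 0 < a z.1 z.2) :
    D.EqBar (D.dx fun x y => Real.log (a x y)) (fun x y => D.dx a x y / a x y) :=
  fun x hx y hy => derivWithin.log ((ha.slice_x hy).differentiableOn (by simp) x hx)
    (hpos (x, y) ⟨hx, hy⟩).ne' (D.uniqueDiffX x hx)

lemma dy_log (ha : D.SmoothOn 1 a) (hpos : ∀ z ∈ D.OmegaBar, 0 < a z.1 z.2) :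
    D.EqBar (D.dy fun x y => Real.log (a x y)) (fun x y => D.dy a x y / a x y) :=
  fun x hx y hy => derivWithin.log ((ha.slice_y hx).differentiableOn (by simp) y hy)
    (hpos (x, y) ⟨hx, hy⟩).ne' (D.uniqueDiffY y hy)

/-- Dividing by `a` isolates `u_xx` and leaves only derivatives of `log a` and the factor `1 / a`,
the form on which `formalJet` is built. -/
lemma dx_dx_eqBar (ha : D.SmoothOn 1 a) (hpos : ∀ z ∈ D.OmegaBar, 0 < a z.1 z.2)
    (h : D.EqBar (D.negDivGrad a u) f) :
    D.EqBar (D.dx (D.dx u)) (fun x y => - D.dy (D.dy u) x y +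
      - ((D.dx (fun x y => Real.log (a x y)) x y * D.dx u x y
        + D.dy (fun x y => Real.log (a x y)) x y * D.dy u x y) + (a x y)⁻¹ * f x y)) := by
  intro x hx y hy
  have hp := (hpos (x, y) ⟨hx, hy⟩).ne'
  dsimp only at hp ⊢
  rw [dx_log ha hpos x hx y hy, dy_log ha hpos x hx y hy, ← h x hx y hy, negDivGrad]
  field_simp
  ring

/-- Differentiating the equation at the base point. -/
lemma pd_add_two (ha : ∀ z ∈ D.OmegaBar, 0 < a z.1 z.2) {m n : ℕ}
    (hsa : D.SmoothOn (m + n + 1 : ℕ) a) (hu : D.SmoothOn (m + n + 2 : ℕ) u)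
    (hf : D.SmoothOn (m + n : ℕ) f) (h : D.EqBar (D.negDivGrad a u) f) :
    D.pd u (m + 2) n = - D.pd u m (n + 2)
      - ∑ i ∈ Finset.range (m + 1), ∑ j ∈ Finset.range (n + 1),
          ((m.choose i : ℝ) * (n.choose j : ℝ)) *
            (D.pd (fun x y => Real.log (a x y)) (i + 1) j * D.pd u (m - i + 1) (n - j)
              + D.pd (fun x y => Real.log (a x y)) i (j + 1) * D.pd u (m - i) (n - j + 1)
              + D.pd (fun x y => (a x y)⁻¹) i j * D.pd f (m - i) (n - j)) := by
  set L : ℝ → ℝ → ℝ := fun x y => Real.log (a x y)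
  set R : ℝ → ℝ → ℝ := fun x y => (a x y)⁻¹
  have ha1 : D.SmoothOn 1 a := hsa.of_le (by exact_mod_cast (by omega))
  have hL : D.SmoothOn (m + n + 1 : ℕ) L := hsa.log ha
  have hR : D.SmoothOn (m + n : ℕ) R := SmoothOn.inv (hsa.of_le (by exact_mod_cast (by omega))) ha
  have hu1 : D.SmoothOn (m + n + 1 : ℕ) u := hu.of_le (by exact_mod_cast (by omega))
  have hux : D.SmoothOn (m + n + 1 : ℕ) (D.dx u) := SmoothOn.dx (hu.of_le (by norm_cast))
  have huy : D.SmoothOn (m + n + 1 : ℕ) (D.dy u) := SmoothOn.dy (hu.of_le (by norm_cast))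
  have huyy : D.SmoothOn (m + n : ℕ) (D.dy (D.dy u)) := SmoothOn.dy (huy.of_le (by norm_cast))
  have hux' : D.SmoothOn (m + n : ℕ) (D.dx u) := SmoothOn.dx (hu1.of_le (by norm_cast))
  have huy' : D.SmoothOn (m + n : ℕ) (D.dy u) := SmoothOn.dy (hu1.of_le (by norm_cast))
  have hLx : D.SmoothOn (m + n : ℕ) (D.dx L) := SmoothOn.dx (hL.of_le (by norm_cast))
  have hLy : D.SmoothOn (m + n : ℕ) (D.dy L) := SmoothOn.dy (hL.of_le (by norm_cast))
  have e1 : D.pd u (m + 2) n = D.pd (D.dx (D.dx u)) m n := by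
    rw [pd_dx (hux.of_le (by exact_mod_cast (by omega))),
      pd_dx (hu.of_le (by exact_mod_cast (by omega)))]
  rw [e1, pd_congr (dx_dx_eqBar ha1 ha h), pd_add huyy.neg
    (((hLx.mul hux').add (hLy.mul huy')).add (hR.mul hf)).neg, pd_neg, pd_dy, pd_dy, pd_neg,
    pd_add ((hLx.mul hux').add (hLy.mul huy')) (hR.mul hf), pd_add (hLx.mul hux') (hLy.mul huy'),
    pd_mul hLx hux', pd_mul hLy huy', pd_mul hR hf, sub_eq_add_neg]
  congr 2
  rw [← Finset.sum_add_distrib, ← Finset.sum_add_distrib]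
  refine Finset.sum_congr rfl fun i hi => ?_
  rw [← Finset.sum_add_distrib, ← Finset.sum_add_distrib]
  refine Finset.sum_congr rfl fun j hj => ?_
  have hi' := Finset.mem_range.1 hi
  have hj' := Finset.mem_range.1 hj
  rw [pd_dx (hL.of_le (by exact_mod_cast (by omega))), pd_dx (hu.of_le (by exact_mod_cast (by omega))),
    pd_dy, pd_dy]
  ring

/-! ### The boundary condition -/

/-- `y₀` is interior to the side, so one-sided and two-sided derivatives in y agree there. -/
lemma bd_eq_iteratedDerivWithin {b : ℝ → ℝ} {n : ℕ} (hb : D.SmoothSide n b) :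
    D.bd b n = iteratedDerivWithin n b (Icc D.l₃ D.l₄) D.y₀ :=
  (iteratedDerivWithin_eq_iteratedDeriv D.uniqueDiffY
    (hb.contDiffAt (Icc_mem_nhds D.hy₃ D.hy₄)) D.y₀_mem).symm

lemma pd_zero_left (w : ℝ → ℝ → ℝ) (n : ℕ) :
    D.pd w 0 n = iteratedDerivWithin n (fun y => w D.l₁ y) (Icc D.l₃ D.l₄) D.y₀ := by
  simp [pd]

/-- Differentiating the boundary condition at the base point. -/
lemma bd_robin {α g : ℝ → ℝ} {n : ℕ} (hα : D.SmoothSide n α) (hu : D.SmoothOn (n + 1 : ℕ) u)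
    (hg : ∀ y ∈ Ioo D.l₃ D.l₄, D.robin α u y = g y) :
    D.bd g n = - D.pd u 1 n
      + ∑ i ∈ Finset.range (n + 1), (n.choose i : ℝ) * D.bd α (n - i) * D.pd u 0 i := by
  have hun : D.SmoothOn n u := hu.of_le (by exact_mod_cast (by omega))
  have hux : D.SmoothOn n (D.dx u) := SmoothOn.dx (hu.of_le (by norm_cast))
  have h1 : ContDiffOn ℝ n (fun y => D.dx u D.l₁ y) (Icc D.l₃ D.l₄) := hux.slice_y D.l₁_mem
  have h2 : ContDiffOn ℝ n (fun y => u D.l₁ y) (Icc D.l₃ D.l₄) := hun.slice_y D.l₁_mem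
  have hα' : ContDiffOn ℝ n α (Icc D.l₃ D.l₄) := hα
  -- The boundary condition holds on the open side only; this is a neighbourhood of `y₀`, which is
  -- enough for derivatives at `y₀`.
  have e : g =ᶠ[𝓝 D.y₀] fun y => - D.dx u D.l₁ y + u D.l₁ y * α y := by
    filter_upwards [Ioo_mem_nhds D.hy₃ D.hy₄] with y hy
    rw [← hg y hy, robin, mul_comm]; rfl
  have h3 : ContDiffOn ℝ n (fun y => - D.dx u D.l₁ y + u D.l₁ y * α y) (Icc D.l₃ D.l₄) :=
    h1.neg.add (h2.mul hα')
  rw [bd, e.iteratedDeriv_eq, ← iteratedDerivWithin_eq_iteratedDeriv D.uniqueDiffY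
    (h3.contDiffAt (Icc_mem_nhds D.hy₃ D.hy₄)) D.y₀_mem,
    iteratedDerivWithin_fun_add D.y₀_mem D.uniqueDiffY (h1.neg _ D.y₀_mem)
      ((h2.mul hα') _ D.y₀_mem), iteratedDerivWithin_fun_neg, ← pd_zero_left, pd_dx
      (hu.of_le (by norm_cast))]
  congr 1
  refine (iteratedDerivWithin_mul D.y₀_mem D.uniqueDiffY (h2 _ D.y₀_mem)
    (hα' _ D.y₀_mem)).trans (Finset.sum_congr rfl fun i hi => ?_)
  rw [bd_eq_iteratedDerivWithin (ContDiffOn.of_le hα (by exact_mod_cast Nat.sub_le n i)),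
    pd_zero_left]
  ring

end SideRect

/-! ### Formal jets of the differential equation -/

/-- `J` satisfies, up to order `N`, the recursion obtained by differentiating the equation. -/
def IsJet (L R F : ℕ → ℕ → ℝ) (N : ℕ) (J : ℕ → ℕ → ℝ) : Prop :=
  ∀ m n, m + n + 2 ≤ N → J (m + 2) n = - J m (n + 2)
      - ∑ i ∈ Finset.range (m + 1), ∑ j ∈ Finset.range (n + 1),
          ((m.choose i : ℝ) * (n.choose j : ℝ)) *
            (L (i + 1) j * J (m - i + 1) (n - j) + L i (j + 1) * J (m - i) (n - j + 1)
              + R i j * F (m - i) (n - j))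

section Jets

variable {L R F F' φ J J' : ℕ → ℕ → ℝ} {N : ℕ}

lemma formalJet_zero (n : ℕ) : formalJet L R φ F 0 n = φ 0 n := by rw [formalJet]

lemma formalJet_one (n : ℕ) : formalJet L R φ F 1 n = φ 1 n := by rw [formalJet]

lemma isJet_formalJet (N : ℕ) : IsJet L R F N (formalJet L R φ F) := fun m n _ => by
  rw [formalJet]

lemma IsJet.mono {M : ℕ} (h : IsJet L R F N J) (hM : M ≤ N) : IsJet L R F M J :=
  fun m n hmn => h m n (hmn.trans hM)

/-- The recursion expresses an entry of column m + 2 through columns up to m + 1 without raising the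
total order. Identities between jets thus reduce to comparing the sources and the columns 0 and 1.
-/
lemma IsJet.unique (hJ : IsJet L R F N J) (hJ' : IsJet L R F' N J')
    (hF : ∀ m n, m + n + 2 ≤ N → F m n = F' m n) (h0 : ∀ n, n ≤ N → J 0 n = J' 0 n)
    (h1 : ∀ n, n + 1 ≤ N → J 1 n = J' 1 n) : ∀ m n, m + n ≤ N → J m n = J' m n := by
  intro m
  induction m using Nat.strong_induction_on with
  | _ m ih =>
    intro n hmn
    match m, ih, hmn with
    | 0, _, hmn => exact h0 n (by omega)
    | 1, _, hmn => exact h1 n (by omega)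
    | m + 2, ih, hmn =>
      rw [hJ m n (by omega), hJ' m n (by omega), ih m (by omega) (n + 2) (by omega)]
      congr 1
      refine Finset.sum_congr rfl fun i hi => Finset.sum_congr rfl fun j hj => ?_
      have hi' := Finset.mem_range.1 hi
      have hj' := Finset.mem_range.1 hj
      rw [ih (m - i + 1) (by omega) (n - j) (by omega), ih (m - i) (by omega) (n - j + 1) (by omega),
        hF (m - i) (n - j) (by omega)]

lemma isJet_zero : IsJet L R (fun _ _ => 0) N (fun _ _ => 0) := fun m n _ => by simp

lemma IsJet.add (h : IsJet L R F N J) (h' : IsJet L R F' N J') :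
    IsJet L R (fun m n => F m n + F' m n) N (fun m n => J m n + J' m n) := fun m n hmn => by
  simp only [h m n hmn, h' m n hmn]
  have : ∀ A B C D E : ℝ, E = C + D → -A - C + (-B - D) = -(A + B) - E := by
    intros; linarith
  refine this _ _ _ _ _ ?_
  simp only [← Finset.sum_add_distrib]
  refine Finset.sum_congr rfl fun i _ => Finset.sum_congr rfl fun j _ => ?_
  ring

lemma IsJet.const_mul (c : ℝ) (h : IsJet L R F N J) :
    IsJet L R (fun m n => c * F m n) N (fun m n => c * J m n) := fun m n hmn => by
  simp only [h m n hmn]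
  have : ∀ A C E : ℝ, E = c * C → c * (-A - C) = -(c * A) - E := by
    rintro A C E rfl; ring
  refine this _ _ _ ?_
  simp only [Finset.mul_sum]
  refine Finset.sum_congr rfl fun i _ => Finset.sum_congr rfl fun j _ => ?_
  ring

lemma IsJet.sum {ι : Type*} (s : Finset ι) (c : ι → ℝ) {F J : ι → ℕ → ℕ → ℝ}
    (h : ∀ i ∈ s, IsJet L R (F i) N (J i)) :
    IsJet L R (fun m n => ∑ i ∈ s, c i * F i m n) N (fun m n => ∑ i ∈ s, c i * J i m n) := by
  classical
  induction s using Finset.induction_on with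
  | empty => simpa using isJet_zero
  | insert i s hi ih =>
    simp only [Finset.sum_insert hi]
    exact ((h i (Finset.mem_insert_self i s)).const_mul (c i)).add
      (ih fun j hj => h j (Finset.mem_insert_of_mem hj))

lemma IsJet.eq_zero_of_lt {d : ℕ} (h : IsJet L R F N J) (hF : ∀ m n, m + n + 2 < d → F m n = 0)
    (h0 : ∀ n, n < d → J 0 n = 0) (h1 : ∀ n, n + 1 < d → J 1 n = 0) (m n : ℕ) (hmn : m + n < d)
    (hN : m + n ≤ N) : J m n = 0 :=
  (h.mono (M := m + n) hN).unique isJet_zero (fun i j hij => hF i j (by omega))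
    (fun i hi => h0 i (by omega)) (fun i hi => h1 i (by omega)) m n le_rfl

/-- The recursion at the lowest order present in the jet. -/
lemma IsJet.lowest {d : ℕ} (h : IsJet L R F N J) (hd : d ≤ N) (hJ : ∀ m n, m + n < d → J m n = 0)
    (hF : ∀ m n, m + n + 2 < d → F m n = 0) {m n : ℕ} (hmn : m + n + 2 = d) :
    J (m + 2) n = - J m (n + 2) - R 0 0 * F m n := by
  rw [h m n (by omega), Finset.sum_eq_single 0, Finset.sum_eq_single 0]
  · simp [hJ (m + 1) n (by omega), hJ m (n + 1) (by omega)]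
  · intro j hj hj0
    have hj' := Finset.mem_range.1 hj
    simp [hJ (m + 1) (n - j) (by omega), hJ m (n - j + 1) (by omega), hF m (n - j) (by omega)]
  · simp
  · intro i hi hi0
    have hi' := Finset.mem_range.1 hi
    refine Finset.sum_eq_zero fun j hj => ?_
    have hj' := Finset.mem_range.1 hj
    simp [hJ (m - i + 1) (n - j) (by omega), hJ (m - i) (n - j + 1) (by omega),
      hF (m - i) (n - j) (by omega)]
  · simp

/-- The recursion one order above the lowest order present in the jet. -/
lemma IsJet.second_lowest {d : ℕ} (h : IsJet L R (fun _ _ => 0) N J) (hd : d + 1 ≤ N)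
    (hJ : ∀ m n, m + n < d → J m n = 0) {m n : ℕ} (hmn : m + n + 1 = d) :
    J (m + 2) n = - J m (n + 2) - (L 1 0 * J (m + 1) n + L 0 1 * J m (n + 1)) := by
  rw [h m n (by omega), Finset.sum_eq_single 0, Finset.sum_eq_single 0]
  · simp
  · intro j hj hj0
    have hj' := Finset.mem_range.1 hj
    simp [hJ (m + 1) (n - j) (by omega), hJ m (n - j + 1) (by omega)]
  · simp
  · intro i hi hi0
    have hi' := Finset.mem_range.1 hi
    refine Finset.sum_eq_zero fun j hj => ?_
    have hj' := Finset.mem_range.1 hj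
    simp [hJ (m - i + 1) (n - j) (by omega), hJ (m - i) (n - j + 1) (by omega)]
  · simp

lemma formalJet_kron_eq_zero_of_lt {m₀ n₀ m n : ℕ} (hmn : m + n < m₀ + n₀) :
    formalJet L R (kron m₀ n₀) (fun _ _ => 0) m n = 0 :=
  (isJet_formalJet (m + n)).eq_zero_of_lt (fun _ _ _ => rfl)
    (fun n hn => by
      rw [formalJet_zero, kron, if_neg]; omega)
    (fun n hn => by
      rw [formalJet_one, kron, if_neg]; omega) m n hmn le_rfl

/-- At lowest order the variable coefficients drop out and the recursion is Laplace's equation: two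
steps in x change the sign, and the parity of the initial column is kept. -/
lemma formalJet_kron_lowest {m₀ n₀ : ℕ} (m : ℕ) : ∀ n, m + n = m₀ + n₀ →
    formalJet L R (kron m₀ n₀) (fun _ _ => 0) m n = if m % 2 = m₀ then (-1) ^ (m / 2) else 0 := by
  induction m using Nat.twoStepInduction with
  | zero =>
    intro n hn
    rw [formalJet_zero, kron]
    congr 1
    simp only [eq_iff_iff]; omega
  | one =>
    intro n hn
    rw [formalJet_one, kron]
    congr 1
    simp only [eq_iff_iff]; omega
  | more m ih _ =>
    intro n hn
    rw [(isJet_formalJet (m₀ + n₀)).lowest le_rfl (fun _ _ h => formalJet_kron_eq_zero_of_lt h)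
      (fun _ _ _ => rfl) (by omega), ih (n + 2) (by omega), Nat.add_mod_right,
      show (m + 2) / 2 = m / 2 + 1 by omega]
    split_ifs <;> simp [pow_succ]

lemma formalJet_source_eq_zero_of_lt {m₀ n₀ m n : ℕ} (hmn : m + n < m₀ + n₀ + 2) :
    formalJet L R (fun _ _ => 0) (kron m₀ n₀) m n = 0 :=
  (isJet_formalJet (m + n)).eq_zero_of_lt (d := m₀ + n₀ + 2)
    (fun m n hmn => by rw [kron, if_neg]; omega)
    (fun n hn => by rw [formalJet_zero]) (fun n hn => by rw [formalJet_one]) m n hmn le_rfl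

/-- At lowest order the recursion is Poisson's equation: the source enters once, in column `m₀ + 2`,
with the factor `-R 0 0`, and then propagates with alternating signs. -/
lemma formalJet_source_lowest {m₀ n₀ : ℕ} (m : ℕ) : ∀ n, m + n = m₀ + n₀ + 2 →
    formalJet L R (fun _ _ => 0) (kron m₀ n₀) m n =
      if m₀ + 2 ≤ m ∧ m % 2 = m₀ % 2 then (-1) ^ ((m - m₀) / 2) * R 0 0 else 0 := by
  induction m using Nat.twoStepInduction with
  | zero => intro n hn; simp [formalJet_zero]
  | one => intro n hn; simp [formalJet_one]
  | more m ih _ =>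
    intro n hn
    rw [(isJet_formalJet (m₀ + n₀ + 2)).lowest le_rfl
      (fun _ _ h => formalJet_source_eq_zero_of_lt h)
      (fun m n hmn => by rw [kron, if_neg]; omega) (by omega), ih (n + 2) (by omega),
      Nat.add_mod_right, kron]
    rcases lt_trichotomy m m₀ with h | rfl | h
    · rw [if_neg (by omega), if_neg (by omega), if_neg (by omega)]; simp
    · rw [if_neg (by omega), if_pos (by omega), if_pos (by omega),
        show (m + 2 - m) / 2 = 1 by omega]; simp
    · rw [if_neg (c := m = m₀ ∧ n = n₀) (by omega)]
      by_cases hp : m % 2 = m₀ % 2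
      · rw [if_pos (by omega), if_pos (by omega),
          show (m + 2 - m₀) / 2 = (m - m₀) / 2 + 1 by omega, pow_succ]; ring
      · rw [if_neg (by omega), if_neg (by omega)]; simp

end Jets

/-! ### The two lowest orders of the homogeneous Robin jets -/

/-- The jet of the solution of the homogeneous equation whose Dirichlet data have the jet `δ_n` and
whose normal derivative is given by the homogeneous Robin condition with the coefficient jet `β`. -/
noncomputable def robinJet (L R : ℕ → ℕ → ℝ) (β : ℕ → ℝ) (n : ℕ) : ℕ → ℕ → ℝ :=
  formalJet L R
    (fun m i => if m = 0 then (if i = n then 1 else 0) else (i.choose n : ℝ) * β (i - n))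
    (fun _ _ => 0)

section RobinJet

variable {L R : ℕ → ℕ → ℝ} {β : ℕ → ℝ} {n : ℕ}

lemma isJet_robinJet (N : ℕ) : IsJet L R (fun _ _ => 0) N (robinJet L R β n) := isJet_formalJet N

lemma robinJet_zero (i : ℕ) : robinJet L R β n 0 i = if i = n then 1 else 0 := formalJet_zero i

lemma robinJet_one (i : ℕ) : robinJet L R β n 1 i = (i.choose n : ℝ) * β (i - n) :=
  formalJet_one i

lemma robinJet_eq_zero_of_lt {m j : ℕ} (h : m + j < n) : robinJet L R β n m j = 0 :=
  (isJet_robinJet (m + j)).eq_zero_of_lt (fun _ _ _ => rfl)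
    (fun i hi => by rw [robinJet_zero, if_neg (by omega)])
    (fun i hi => by rw [robinJet_one, Nat.choose_eq_zero_of_lt (by omega)]; simp) m j h le_rfl

/-- The Robin data in column 1 start only at order n + 1, so the leading part is the harmonic
polynomial even in x, `Re (y + ix)^n / n!`. -/
lemma robinJet_lowest (m : ℕ) : ∀ j, m + j = n →
    robinJet L R β n m j = if m % 2 = 0 then (-1) ^ (m / 2) else 0 := by
  induction m using Nat.twoStepInduction with
  | zero => intro j hj; rw [robinJet_zero, if_pos (by omega)]; simp
  | one => intro j hj; rw [robinJet_one, Nat.choose_eq_zero_of_lt (by omega)]; simp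
  | more m ih _ =>
    intro j hj
    rw [(isJet_robinJet n).lowest le_rfl (fun _ _ h => robinJet_eq_zero_of_lt h)
      (fun _ _ _ => rfl) (by omega), ih (j + 2) (by omega), Nat.add_mod_right,
      show (m + 2) / 2 = m / 2 + 1 by omega]
    split_ifs <;> simp [pow_succ]

/-- Each pair of steps in x picks up one further first-order term, with the coefficient `L 0 1` or
`L 1 0` according to parity, applied to the leading part; this accumulates to the factor `m / 2`.
The value `β 0` enters through column 1. -/
lemma robinJet_second_lowest (m : ℕ) : ∀ j, m + j = n + 1 →
    robinJet L R β n m j = if m % 2 = 0 then (-1) ^ (m / 2) * ((m / 2 : ℕ) * L 0 1)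
      else (-1) ^ (m / 2) * (β 0 - (m / 2 : ℕ) * L 1 0) := by
  induction m using Nat.twoStepInduction with
  | zero => intro j hj; rw [robinJet_zero, if_neg (by omega)]; simp
  | one =>
    intro j hj
    obtain rfl : j = n := by omega
    rw [robinJet_one]; simp
  | more m ih _ =>
    intro j hj
    rw [(isJet_robinJet (n + 1)).second_lowest le_rfl (fun _ _ h => robinJet_eq_zero_of_lt h)
      (by omega), ih (j + 2) (by omega), robinJet_lowest (m + 1) j (by omega),
      robinJet_lowest m (j + 1) (by omega), Nat.add_mod_right,
      show (m + 2) / 2 = m / 2 + 1 by omega]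
    by_cases hm : m % 2 = 0
    · rw [if_pos hm, if_neg (by omega), if_pos hm, if_pos hm]
      push_cast; rw [pow_succ]; ring
    · rw [if_neg hm, if_pos (by omega), if_neg hm, if_neg hm,
        show (m + 1) / 2 = m / 2 + 1 by omega]
      push_cast; rw [pow_succ]; ring

end RobinJet

lemma jetPoly_congr {J J' : ℕ → ℕ → ℝ} {N : ℕ} (h : ∀ m n, m + n ≤ N → J m n = J' m n)
    (x y : ℝ) : jetPoly J N x y = jetPoly J' N x y :=
  Finset.sum_congr rfl fun p hp => by rw [h p.1 p.2 (mem_Lam.1 hp)]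

lemma jetPoly_add (J J' : ℕ → ℕ → ℝ) (N : ℕ) (x y : ℝ) :
    jetPoly (fun m n => J m n + J' m n) N x y = jetPoly J N x y + jetPoly J' N x y := by
  simp only [jetPoly, add_mul, Finset.sum_add_distrib]

lemma jetPoly_sum {ι : Type*} (s : Finset ι) (c : ι → ℝ) (J : ι → ℕ → ℕ → ℝ) (N : ℕ) (x y : ℝ) :
    jetPoly (fun m n => ∑ i ∈ s, c i * J i m n) N x y = ∑ i ∈ s, c i * jetPoly (J i) N x y := by
  simp only [jetPoly, Finset.sum_mul, Finset.mul_sum]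
  rw [Finset.sum_comm]
  simp only [mul_assoc]

lemma mem_LamV2 {K : ℕ} {p : ℕ × ℕ} : p ∈ LamV2 K ↔ p.1 + p.2 ≤ K ∧ 2 ≤ p.1 := by
  simp only [LamV2, Finset.mem_filter, mem_Lam]

/-! ### The polynomials G and Q as jet polynomials -/

namespace SideRect

variable {D : SideRect} {a : ℝ → ℝ → ℝ}

/-- The explicit sum in `GV` is the lowest-order part of the jet. All other entries outside the
second index set vanish: those of lower order, those of lowest order with the wrong parity, and
those of higher order in columns 0 and 1. -/
lemma jetPoly_AVu {m₀ n₀ M : ℕ} (hm₀ : m₀ ≤ 1) (h : m₀ + n₀ ≤ M + 1) (x y : ℝ) :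
    jetPoly (fun m n => D.AVu a m n m₀ n₀) (M + 1) x y = D.GV a M m₀ n₀ x y := by
  have hsub : LamV2 (M + 1) \ LamV2 (m₀ + n₀) ⊆ Lam (M + 1) := fun p hp =>
    mem_Lam.2 (mem_LamV2.1 (Finset.mem_sdiff.1 hp).1).1
  rw [jetPoly, ← Finset.sum_sdiff hsub, GV]
  congr 1
  have hinj : Set.InjOn (fun l : ℕ => (m₀ + 2 * l, n₀ - 2 * l)) (Finset.range (n₀ / 2 + 1)) := by
    intro l _ l' _ hl
    simp only [Prod.mk.injEq] at hl
    omega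
  rw [← Finset.sum_subset (s₁ := (Finset.range (n₀ / 2 + 1)).image
    fun l => (m₀ + 2 * l, n₀ - 2 * l)), Finset.sum_image hinj]
  · refine Finset.sum_congr rfl fun l hl => ?_
    have hl' := Finset.mem_range.1 hl
    simp only [AVu]
    rw [formalJet_kron_lowest _ _ (by omega), if_pos (by omega),
      show (m₀ + 2 * l) / 2 = l by omega]
    ring
  · intro p hp
    obtain ⟨l, hl, rfl⟩ := Finset.mem_image.1 hp
    have hl' := Finset.mem_range.1 hl
    simp only [Finset.mem_sdiff, mem_Lam, mem_LamV2]
    omega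
  · rintro ⟨m, n⟩ hp hp'
    simp only [Finset.mem_sdiff, mem_Lam, mem_LamV2] at hp
    have hne : ∀ l, l ≤ n₀ / 2 → ¬ (m₀ + 2 * l = m ∧ n₀ - 2 * l = n) := fun l hl e =>
      hp' (Finset.mem_image.2 ⟨l, Finset.mem_range.2 (by omega), by simp [e.1, e.2]⟩)
    have hz : D.AVu a m n m₀ n₀ = 0 := by
      rw [AVu]
      rcases lt_trichotomy (m + n) (m₀ + n₀) with hlt | heq | hgt
      · exact formalJet_kron_eq_zero_of_lt hlt
      · rw [formalJet_kron_lowest _ _ heq, if_neg]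
        intro hmod
        exact hne (m / 2) (by omega) (by omega)
      · have hm : m = 0 ∨ m = 1 := by omega
        rcases hm with rfl | rfl
        · rw [formalJet_zero, kron, if_neg (by omega)]
        · rw [formalJet_one, kron, if_neg (by omega)]
    simp [hz]

lemma jetPoly_AVf {m₀ n₀ M : ℕ} (h : m₀ + n₀ + 2 ≤ M + 1) (x y : ℝ) :
    jetPoly (fun m n => D.AVf a m n m₀ n₀) (M + 1) x y = D.QV a M m₀ n₀ x y := by
  have hsub : LamV2 (M + 1) \ LamV2 (m₀ + n₀ + 2) ⊆ Lam (M + 1) := fun p hp =>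
    mem_Lam.2 (mem_LamV2.1 (Finset.mem_sdiff.1 hp).1).1
  rw [jetPoly, ← Finset.sum_sdiff hsub, QV]
  congr 1
  have hinj : Set.InjOn (fun l : ℕ => (m₀ + 2 * l, n₀ + 2 - 2 * l))
      (Finset.Icc 1 (1 + n₀ / 2)) := by
    intro l _ l' _ hl
    simp only [Prod.mk.injEq] at hl
    omega
  rw [← Finset.sum_subset (s₁ := (Finset.Icc 1 (1 + n₀ / 2)).image
    fun l => (m₀ + 2 * l, n₀ + 2 - 2 * l)), Finset.sum_image hinj]
  · refine Finset.sum_congr rfl fun l hl => ?_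
    have hl' := Finset.mem_Icc.1 hl
    simp only [AVf]
    rw [formalJet_source_lowest _ _ (by omega), if_pos (by omega),
      show (m₀ + 2 * l - m₀) / 2 = l by omega, pd_zero_zero]
    ring
  · intro p hp
    obtain ⟨l, hl, rfl⟩ := Finset.mem_image.1 hp
    have hl' := Finset.mem_Icc.1 hl
    simp only [Finset.mem_sdiff, mem_Lam, mem_LamV2]
    omega
  · rintro ⟨m, n⟩ hp hp'
    simp only [Finset.mem_sdiff, mem_Lam, mem_LamV2] at hp
    have hne : ∀ l, 1 ≤ l → l ≤ 1 + n₀ / 2 → ¬ (m₀ + 2 * l = m ∧ n₀ + 2 - 2 * l = n) :=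
      fun l hl hl' e =>
        hp' (Finset.mem_image.2 ⟨l, Finset.mem_Icc.2 (by omega), by simp [e.1, e.2]⟩)
    have hz : D.AVf a m n m₀ n₀ = 0 := by
      rw [AVf]
      rcases lt_trichotomy (m + n) (m₀ + n₀ + 2) with hlt | heq | hgt
      · exact formalJet_source_eq_zero_of_lt hlt
      · rw [formalJet_source_lowest _ _ heq, if_neg]
        intro hmod
        exact hne ((m - m₀) / 2) (by omega) (by omega) (by omega)
      · have hm : m = 0 ∨ m = 1 := by omega
        rcases hm with rfl | rfl
        · rw [formalJet_zero]
        · rw [formalJet_one]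
    simp [hz]

/-- The jets in the linear system for the coefficients of the scheme. -/
noncomputable def sysJet (D : SideRect) (a : ℝ → ℝ → ℝ) (α : ℝ → ℝ) (n : ℕ) : ℕ → ℕ → ℝ :=
  robinJet (D.pd fun x y => Real.log (a x y)) (D.pd fun x y => (a x y)⁻¹) (D.bd α) n

/-- Superposition: both sides come from jets of the homogeneous equation with the same columns 0 and
1. The sum ends at i = 5 because the entry (1, 6) already has order seven. -/
lemma jetPoly_sysJet (α : ℝ → ℝ) {n : ℕ} (hn : n ≤ 6) (x y : ℝ) :
    jetPoly (D.sysJet a α n) 6 x y = D.GV a 5 0 n x y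
        + ∑ i ∈ Finset.Icc n 5, (i.choose n : ℝ) * D.bd α (i - n) * D.GV a 5 1 i x y := by
  have h0 := jetPoly_AVu (D := D) (a := a) (m₀ := 0) (n₀ := n) (M := 5) (by omega) (by omega) x y
  have h1 : ∀ i ∈ Finset.Icc n 5, (i.choose n : ℝ) * D.bd α (i - n) * D.GV a 5 1 i x y =
      (i.choose n : ℝ) * D.bd α (i - n) * jetPoly (fun m n => D.AVu a m n 1 i) 6 x y := by
    intro i hi
    have hi' := Finset.mem_Icc.1 hi
    rw [jetPoly_AVu (by omega) (by omega)]
  rw [← h0, Finset.sum_congr rfl h1, ← jetPoly_sum, ← jetPoly_add]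
  refine jetPoly_congr ?_ x y
  refine (isJet_robinJet 6).unique ((isJet_formalJet 6).add (IsJet.sum _ _ fun i _ =>
    isJet_formalJet 6)) (fun _ _ _ => by simp) (fun i hi => ?_) (fun i hi => ?_)
  · simp [robinJet_zero, AVu, formalJet_zero, kron]
  · rw [robinJet_one]
    simp only [AVu, formalJet_one, kron]
    by_cases hin : n ≤ i
    · rw [Finset.sum_eq_single i]
      · simp
      · intro b _ hb; simp [hb.symm]
      · intro hi'; exact absurd (Finset.mem_Icc.2 ⟨hin, by omega⟩) hi'
    · rw [Nat.choose_eq_zero_of_lt (by omega), Finset.sum_eq_zero]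
      · simp
      · intro b hb
        have := (Finset.mem_Icc.1 hb).1
        rw [if_neg (by omega)]; simp

end SideRect

/-! ### Expansion of exact solutions and the truncation error -/

namespace SideRect

variable {D : SideRect} {a u f : ℝ → ℝ → ℝ} {α g : ℝ → ℝ}

lemma IsExactSolution.eqBar {r : ℕ∞} (ha : D.SmoothOn 1 a) (h : D.IsExactSolution a α r u f g) :
    D.EqBar (D.negDivGrad a u) f :=
  negDivGrad_eqBar ha (h.smooth_u.of_le le_add_self) (h.smooth_f.of_le bot_le) h.pde

/-- The jet of an exact solution satisfies the differentiated equation. -/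
lemma isJet_pd {N : ℕ} (hpos : ∀ z ∈ D.OmegaBar, 0 < a z.1 z.2) (ha : D.SmoothOn (N + 1 : ℕ) a)
    (hu : D.SmoothOn (N + 2 : ℕ) u) (hf : D.SmoothOn N f) (h : D.EqBar (D.negDivGrad a u) f) :
    IsJet (D.pd fun x y => Real.log (a x y)) (D.pd fun x y => (a x y)⁻¹) (D.pd f) (N + 2)
      (D.pd u) := fun m n hmn =>
  pd_add_two hpos (ha.of_le (by exact_mod_cast (by omega))) (hu.of_le (by exact_mod_cast hmn))
    (hf.of_le (by exact_mod_cast (by omega))) h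

/-- The Taylor polynomial of an exact solution in terms of the Dirichlet data and the data `f`, `g`. -/
lemma jetPoly_pd (hpos : ∀ z ∈ D.OmegaBar, 0 < a z.1 z.2) (ha : D.SmoothOn 6 a)
    (hα : D.SmoothSide 5 α) (h : D.IsExactSolution a α 5 u f g) (x y : ℝ) :
    jetPoly (D.pd u) 6 x y =
      ∑ n ∈ Finset.range 7, D.pd u 0 n * jetPoly (D.sysJet a α n) 6 x y
        + (∑ n ∈ Finset.range 6, (- D.bd g n) * D.GV a 5 1 n x y
          + ∑ p ∈ Lam 4, D.pd f p.1 p.2 * D.QV a 5 p.1 p.2 x y) := by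
  have hu : D.SmoothOn (6 : ℕ) u := h.smooth_u.of_le (by exact_mod_cast (by norm_num))
  -- The boundary condition solved for the normal derivative; the sum may run over all seven indices
  -- since the extra binomial coefficients vanish.
  have hbc : ∀ n, n + 1 ≤ 6 → D.pd u 1 n =
      ∑ i ∈ Finset.range 7, D.pd u 0 i * ((n.choose i : ℝ) * D.bd α (n - i)) - D.bd g n := by
    intro n hn
    have hα' : D.SmoothSide n α := ContDiffOn.of_le hα (by exact_mod_cast (by omega))
    rw [bd_robin hα' (hu.of_le (by exact_mod_cast hn)) h.bc,
      Finset.sum_subset (Finset.range_subset_range.2 (show n + 1 ≤ 7 by omega))]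
    · simp only [mul_comm (D.pd u 0 _)]; ring
    · intro i _ hi
      rw [Nat.choose_eq_zero_of_lt (by simpa using hi)]; simp
  have h1 : ∀ n ∈ Finset.range 6, (- D.bd g n) * D.GV a 5 1 n x y =
      (- D.bd g n) * jetPoly (fun i j => D.AVu a i j 1 n) 6 x y := fun n hn => by
    have hn' := Finset.mem_range.1 hn
    rw [jetPoly_AVu le_rfl (by omega)]
  have h2 : ∀ p ∈ Lam 4, D.pd f p.1 p.2 * D.QV a 5 p.1 p.2 x y =
      D.pd f p.1 p.2 * jetPoly (fun i j => D.AVf a i j p.1 p.2) 6 x y := fun p hp => by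
    have hp' := mem_Lam.1 hp
    rw [jetPoly_AVf (by omega)]
  rw [Finset.sum_congr rfl h1, Finset.sum_congr rfl h2, ← jetPoly_sum, ← jetPoly_sum,
    ← jetPoly_sum, ← jetPoly_add, ← jetPoly_add]
  refine jetPoly_congr ?_ x y
  refine (isJet_pd (N := 4) hpos (ha.of_le (by exact_mod_cast (by norm_num)))
    hu (h.smooth_f.of_le (by exact_mod_cast (by norm_num)))
    (h.eqBar (ha.of_le (by exact_mod_cast (by norm_num))))).unique
    (((IsJet.sum _ _ fun i _ => isJet_robinJet 6)).add
      ((IsJet.sum _ _ fun i _ => isJet_formalJet 6).add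
      (IsJet.sum _ _ fun i _ => isJet_formalJet 6))) (fun m n hmn => ?_) (fun i hi => ?_)
      (fun i hi => ?_)
  · rw [Finset.sum_eq_single_of_mem (f := fun p : ℕ × ℕ => D.pd f p.1 p.2 * kron p.1 p.2 m n)
      (m, n) (mem_Lam.2 (by simp only; omega))]
    · simp [kron]
    · rintro ⟨i, j⟩ _ hij
      have : ¬ (m = i ∧ n = j) := fun e => hij (by simp [e.1, e.2])
      simp [kron, this]
  · simp only [sysJet, robinJet_zero, AVu, AVf, formalJet_zero, kron]
    simp
    omega
  · simp only [sysJet, robinJet_one, AVu, AVf, formalJet_one, kron]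
    rw [hbc i hi, sub_eq_add_neg]
    congr 1
    simp
    omega

lemma polyC_isBigO_one (c : ℤ × ℤ → ℕ → ℝ) (s : ℤ × ℤ) :
    polyC c s =O[𝓝[>] 0] fun _ => (1 : ℝ) := by
  have : Continuous (polyC c s) := by unfold polyC; fun_prop
  exact (this.tendsto 0).isBigO_one ℝ |>.mono nhdsWithin_le_nhds

lemma tendsto_polyC (c : ℤ × ℤ → ℕ → ℝ) (s : ℤ × ℤ) :
    Tendsto (polyC c s) (𝓝[>] 0) (𝓝 (c s 0)) := by
  have : Continuous (polyC c s) := by unfold polyC; fun_prop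
  have h0 : polyC c s 0 = c s 0 := by simp [polyC, Finset.sum_range_succ]
  rw [← h0]
  exact (this.tendsto 0).mono_left nhdsWithin_le_nhds

lemma solvesSystem_iff {c : ℤ × ℤ → ℕ → ℝ} : D.SolvesSystem a α c ↔ ∀ n ≤ 6,
    (fun h : ℝ => ∑ s ∈ stencil, polyC c s h * jetPoly (D.sysJet a α n) 6 (s.1 * h) (s.2 * h))
      =O[𝓝[>] 0] fun h : ℝ => h ^ 7 := by
  unfold SolvesSystem
  refine forall_congr' fun n => ?_
  rw [Finset.mem_range, Nat.lt_succ_iff]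
  refine forall_congr' fun hn => ?_
  simp only [jetPoly_sysJet α hn]

lemma inv_mul_isBigO {F : ℝ → ℝ} {p : ℕ} (hF : F =O[𝓝[>] 0] fun h : ℝ => h ^ (p + 1)) :
    (fun h : ℝ => h⁻¹ * F h) =O[𝓝[>] 0] fun h : ℝ => h ^ p := by
  refine ((isBigO_refl (fun h : ℝ => h⁻¹) (𝓝[>] 0)).mul hF).congr' EventuallyEq.rfl ?_
  filter_upwards [self_mem_nhdsWithin] with h hh
  have : h ≠ 0 := ne_of_gt hh
  rw [pow_succ']
  field_simp

/-- Exactly two terms remain after the right-hand side is subtracted: Taylor remainders times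
bounded coefficients, and the Dirichlet derivatives times the sums in (*). Both are O(h^7), and the
scaling costs one power. -/
theorem SolvesSystem.hasTruncationOrder {c : ℤ × ℤ → ℕ → ℝ}
    (hpos : ∀ z ∈ D.OmegaBar, 0 < a z.1 z.2) (ha : D.SmoothOn 6 a)
    (hα : D.SmoothSide 5 α) (hc : D.SolvesSystem a α c) :
    (D.robinScheme a c).HasTruncationOrder D a α 5 6 := by
  intro u f g h
  refine inv_mul_isBigO ?_
  rw [solvesSystem_iff] at hc
  have hu : D.SmoothOn (6 + 1 : ℕ) u := h.smooth_u.of_le (by exact_mod_cast (by norm_num))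
  have h1 : (fun h : ℝ => ∑ s ∈ stencil, polyC c s h * (u (D.l₁ + s.1 * h) (D.y₀ + s.2 * h)
      - jetPoly (D.pd u) 6 (s.1 * h) (s.2 * h))) =O[𝓝[>] 0] fun h : ℝ => h ^ 7 :=
    IsBigO.fun_sum fun s hs => by simpa using (polyC_isBigO_one c s).mul (taylor_ray hu hs)
  have h2 : (fun h : ℝ => ∑ n ∈ Finset.range 7, D.pd u 0 n * ∑ s ∈ stencil,
      polyC c s h * jetPoly (D.sysJet a α n) 6 (s.1 * h) (s.2 * h))
      =O[𝓝[>] 0] fun h : ℝ => h ^ 7 :=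
    IsBigO.fun_sum fun n hn => (hc n (Nat.lt_succ_iff.1 (Finset.mem_range.1 hn))).const_mul_left _
  refine (h1.add h2).congr_left fun t => ?_
  simp only [SixPointScheme.lhs, SixPointScheme.rhs, robinScheme, jetPoly_pd hpos ha hα h,
    Finset.mul_sum, mul_sub, mul_add, Finset.sum_sub_distrib, Finset.sum_add_distrib, mul_neg,
    neg_mul, Finset.sum_neg_distrib]
  rw [Finset.sum_comm (s := stencil) (t := Finset.range 7),
    Finset.sum_comm (s := stencil) (t := Finset.range 6),
    Finset.sum_comm (s := stencil) (t := Lam 4)]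
  simp only [mul_left_comm (polyC c _ t)]
  ring

end SideRect

/-! ### Linear algebra on the six-point stencil -/

lemma sum_stencil {M : Type*} [AddCommMonoid M] (F : ℤ × ℤ → M) :
    ∑ s ∈ stencil, F s =
      F (0, -1) + (F (0, 0) + F (0, 1)) + (F (1, -1) + (F (1, 0) + F (1, 1))) := by
  simp [stencil, Finset.sum_product]

lemma forall_stencil {p : ℤ × ℤ → Prop} : (∀ s ∈ stencil, p s) ↔
    p (0, -1) ∧ p (0, 0) ∧ p (0, 1) ∧ p (1, -1) ∧ p (1, 0) ∧ p (1, 1) := by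
  refine ⟨fun h => ⟨h _ (by decide), h _ (by decide), h _ (by decide), h _ (by decide),
    h _ (by decide), h _ (by decide)⟩, ?_⟩
  rintro ⟨h1, h2, h3, h4, h5, h6⟩ ⟨k, l⟩ hs
  simp only [stencil, Finset.mem_product, Finset.mem_insert, Finset.mem_singleton] at hs
  obtain ⟨rfl | rfl, rfl | rfl | rfl⟩ := hs <;> assumption

/-- The degree `d` part of a jet polynomial, summed over the stencil with the weights `v`. -/
noncomputable def pair (J : ℕ → ℕ → ℝ) (d : ℕ) (v : ℤ × ℤ → ℝ) : ℝ :=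
  ∑ s ∈ stencil, v s * homogPart J d s.1 s.2

/-- The weights of the leading order 6-point scheme. -/
noncomputable def leadWeight (s : ℤ × ℤ) : ℝ :=
  if s.1 = 0 then (if s.2 = 0 then -10 else 2) else (if s.2 = 0 then 4 else 1)

/-- Coefficients of a right inverse of the leading order system. -/
noncomputable def solCoef (s : ℤ × ℤ) : Fin 5 → ℝ :=
  if s = (1, 1) then ![0, 1 / 3, 0, -1 / 3, 0]
  else if s = (1, 0) then ![0, 2 / 3, -1 / 2, -2 / 3, 1 / 2]
  else if s = (0, -1) then ![0, 0, 1 / 4, -1 / 2, 1 / 4]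
  else if s = (0, 1) then ![0, 2 / 3, 1 / 4, -1 / 6, 1 / 4]
  else if s = (0, 0) then ![1, -5 / 3, 0, 5 / 3, -1]
  else 0

/-- The solution, vanishing at `(1, -1)`, of the leading order system with right-hand side `ρ`. -/
noncomputable def solVec (ρ : ℕ → ℝ) (s : ℤ × ℤ) : ℝ := ∑ n : Fin 5, solCoef s n * ρ n

section Pair

variable {L R : ℕ → ℕ → ℝ} {β : ℕ → ℝ}

lemma homogPart_robinJet_lowest (n : ℕ) (x y : ℝ) :
    homogPart (robinJet L R β n) n x y = ∑ m ∈ Finset.range (n + 1),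
      (if m % 2 = 0 then (-1) ^ (m / 2) else 0)
        * (x ^ m * y ^ (n - m) / ((m.factorial : ℝ) * ((n - m).factorial : ℝ))) := by
  rw [homogPart, Finset.Nat.sum_antidiagonal_eq_sum_range_succ_mk]
  refine Finset.sum_congr rfl fun m hm => ?_
  have hm' := Finset.mem_range.1 hm
  rw [robinJet_lowest m (n - m) (by omega)]

lemma homogPart_robinJet_second_lowest (n : ℕ) (x y : ℝ) :
    homogPart (robinJet L R β n) (n + 1) x y = ∑ m ∈ Finset.range (n + 2),
      (if m % 2 = 0 then (-1) ^ (m / 2) * ((m / 2 : ℕ) * L 0 1)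
          else (-1) ^ (m / 2) * (β 0 - (m / 2 : ℕ) * L 1 0))
        * (x ^ m * y ^ (n + 1 - m) / ((m.factorial : ℝ) * ((n + 1 - m).factorial : ℝ))) := by
  rw [homogPart, Finset.Nat.sum_antidiagonal_eq_sum_range_succ_mk]
  refine Finset.sum_congr rfl fun m hm => ?_
  have hm' := Finset.mem_range.1 hm
  rw [robinJet_second_lowest m (n + 1 - m) (by omega)]

lemma homogPart_robinJet_of_lt {n d : ℕ} (h : d < n) (x y : ℝ) :
    homogPart (robinJet L R β n) d x y = 0 :=
  Finset.sum_eq_zero fun p hp => by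
    rw [robinJet_eq_zero_of_lt (by rw [Finset.HasAntidiagonal.mem_antidiagonal.1 hp]; exact h),
      zero_mul]

/-- This and the next six formulas evaluate `Re z^n / n!` at z = y + ix for the stencil points 0,
±1, i, i ± 1. Each value is even or odd under y ↦ -y according to the parity of n. -/
lemma pair_zero (v : ℤ × ℤ → ℝ) : pair (robinJet L R β 0) 0 v =
    v (0, -1) + v (0, 0) + v (0, 1) + v (1, -1) + v (1, 0) + v (1, 1) := by
  simp [pair, sum_stencil, homogPart_robinJet_lowest]
  ring

lemma pair_one (v : ℤ × ℤ → ℝ) : pair (robinJet L R β 1) 1 v =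
    v (0, 1) - v (0, -1) + (v (1, 1) - v (1, -1)) := by
  simp [pair, sum_stencil, homogPart_robinJet_lowest, Finset.sum_range_succ]
  ring

lemma pair_two (v : ℤ × ℤ → ℝ) : pair (robinJet L R β 2) 2 v =
    (v (0, 1) + v (0, -1) - v (1, 0)) / 2 := by
  simp [pair, sum_stencil, homogPart_robinJet_lowest, Finset.sum_range_succ]
  ring

lemma pair_three (v : ℤ × ℤ → ℝ) : pair (robinJet L R β 3) 3 v =
    (v (0, 1) - v (0, -1) - 2 * (v (1, 1) - v (1, -1))) / 6 := by
  simp [pair, sum_stencil, homogPart_robinJet_lowest, Finset.sum_range_succ, Nat.factorial]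
  ring

lemma pair_four (v : ℤ × ℤ → ℝ) : pair (robinJet L R β 4) 4 v =
    (v (0, 1) + v (0, -1) + v (1, 0) - 4 * (v (1, 1) + v (1, -1))) / 24 := by
  simp [pair, sum_stencil, homogPart_robinJet_lowest, Finset.sum_range_succ, Nat.factorial]
  ring

/-- Only two antisymmetric combinations of weights exist, so this functional depends on those of
degrees 1 and 3. -/
lemma pair_five (v : ℤ × ℤ → ℝ) : pair (robinJet L R β 5) 5 v =
    (v (0, 1) - v (0, -1) - 4 * (v (1, 1) - v (1, -1))) / 120 := by
  simp [pair, sum_stencil, homogPart_robinJet_lowest, Finset.sum_range_succ, Nat.factorial]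
  ring

/-- A multiple of the functional of degree 2. This coincidence is the source of the order barrier.
-/
lemma pair_six (v : ℤ × ℤ → ℝ) : pair (robinJet L R β 6) 6 v =
    (v (0, 1) + v (0, -1) - v (1, 0)) / 720 := by
  simp [pair, sum_stencil, homogPart_robinJet_lowest, Finset.sum_range_succ, Nat.factorial]
  ring

lemma pair_zero_second (v : ℤ × ℤ → ℝ) : pair (robinJet L R β 0) 1 v =
    β 0 * (v (1, -1) + v (1, 0) + v (1, 1)) := by
  have := fun x y => homogPart_robinJet_second_lowest (L := L) (R := R) (β := β) 0 x y
  simp only [zero_add] at this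
  simp [pair, sum_stencil, this, Finset.sum_range_succ]
  ring

lemma pair_one_second : pair (robinJet L R β 1) 2 leadWeight = -3 * L 0 1 := by
  have := fun x y => homogPart_robinJet_second_lowest (L := L) (R := R) (β := β) 1 x y
  norm_num at this
  simp [pair, sum_stencil, this, Finset.sum_range_succ, leadWeight]
  ring

lemma pair_three_second : pair (robinJet L R β 3) 4 leadWeight = 0 := by
  have := fun x y => homogPart_robinJet_second_lowest (L := L) (R := R) (β := β) 3 x y
  norm_num at this
  simp [pair, sum_stencil, this, Finset.sum_range_succ, leadWeight, Nat.factorial]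
  ring

lemma pair_five_second : pair (robinJet L R β 5) 6 leadWeight = L 0 1 / 60 := by
  have := fun x y => homogPart_robinJet_second_lowest (L := L) (R := R) (β := β) 5 x y
  norm_num at this
  simp [pair, sum_stencil, this, Finset.sum_range_succ, leadWeight, Nat.factorial]
  ring

/-- The leading parts of degrees 6 and 2 cancel in this combination for every weight vector, so a
scheme of order seven needs its next-order part to vanish on the leading weights. -/
lemma pair_obstruction : 720 * pair (robinJet L R β 6) 7 leadWeight
    - 2 * pair (robinJet L R β 2) 3 leadWeight = -(10 / 7) * (2 * β 0 + L 1 0) := by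
  have h6 := fun x y => homogPart_robinJet_second_lowest (L := L) (R := R) (β := β) 6 x y
  have h2 := fun x y => homogPart_robinJet_second_lowest (L := L) (R := R) (β := β) 2 x y
  norm_num at h6 h2
  simp [pair, sum_stencil, h6, h2, Finset.sum_range_succ, leadWeight, Nat.factorial]
  ring

lemma pair_solVec (ρ : ℕ → ℝ) {n : ℕ} (hn : n ≤ 4) :
    pair (robinJet L R β n) n (solVec ρ) = ρ n / n.factorial := by
  interval_cases n
  · rw [pair_zero]; simp [solVec, solCoef, Fin.sum_univ_five]; ring
  · rw [pair_one]; simp [solVec, solCoef, Fin.sum_univ_five]; ring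
  · rw [pair_two]; simp [solVec, solCoef, Fin.sum_univ_five]; ring
  · rw [pair_three]; simp [solVec, solCoef, Fin.sum_univ_five, Nat.factorial]; ring
  · rw [pair_four]; simp [solVec, solCoef, Fin.sum_univ_five, Nat.factorial]; ring

/-- `leadWeight` equals 1 at (1, -1) and is annihilated by the five functionals; once its multiple
is removed, the other five values are determined by the five pairings. -/
lemma eq_leadWeight_add_solVec (v : ℤ × ℤ → ℝ) : ∀ s ∈ stencil, v s = v (1, -1) * leadWeight s
    + solVec (fun n => n.factorial * pair (robinJet L R β n) n v) s := by
  rw [forall_stencil]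
  simp only [solVec, Fin.sum_univ_five]
  simp [solCoef, pair_zero, pair_one, pair_two, pair_three, pair_four, Nat.factorial, leadWeight]
  refine ⟨?_, ?_, ?_, ?_, ?_⟩ <;> ring

/-- For polynomials even in x the folded weights act as half of the compact nine-point Laplacian,
which annihilates harmonic polynomials through degree seven. -/
lemma pair_leadWeight {n : ℕ} (hn : n ≤ 6) : pair (robinJet L R β n) n leadWeight = 0 := by
  interval_cases n
  · rw [pair_zero]; norm_num [leadWeight]
  · rw [pair_one]; norm_num [leadWeight]
  · rw [pair_two]; norm_num [leadWeight]
  · rw [pair_three]; norm_num [leadWeight]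
  · rw [pair_four]; norm_num [leadWeight]
  · rw [pair_five]; norm_num [leadWeight]
  · rw [pair_six]; norm_num [leadWeight]

lemma pair_of_lt {n d : ℕ} (h : d < n) (v : ℤ × ℤ → ℝ) : pair (robinJet L R β n) d v = 0 :=
  Finset.sum_eq_zero fun s _ => by rw [homogPart_robinJet_of_lt h, mul_zero]

/-- The coefficients of the scheme can be found order by order. -/
lemma exists_coeff (L R : ℕ → ℕ → ℝ) (β : ℕ → ℝ) (K : ℕ) : ∃ d : ℕ → ℤ × ℤ → ℝ,
    d 0 = leadWeight ∧ ∀ j ≤ K, ∀ n, n + j ≤ 6 →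
      ∑ i ∈ Finset.range (j + 1), pair (robinJet L R β n) (n + j - i) (d i) = 0 := by
  induction K with
  | zero =>
    refine ⟨fun _ => leadWeight, rfl, fun j hj n hn => ?_⟩
    obtain rfl : j = 0 := by omega
    simpa using pair_leadWeight (by omega)
  | succ K ih =>
    obtain ⟨d, hd0, hd⟩ := ih
    -- The right-hand side that the coefficients already chosen impose on the new coefficient
    -- vector.
    let t : ℕ → ℝ := fun n => - ∑ i ∈ Finset.range (K + 1),
      pair (robinJet L R β n) (n + (K + 1) - i) (d i)
    let v := solVec fun n => n.factorial * t n
    have hv : ∀ n ≤ 4, pair (robinJet L R β n) n v = t n := fun n hn => by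
      rw [pair_solVec _ hn]
      have : (n.factorial : ℝ) ≠ 0 := by positivity
      field_simp
    refine ⟨Function.update d (K + 1) v, by simp [hd0], fun j hj n hn => ?_⟩
    have hlow : ∀ j ≤ K + 1, ∑ i ∈ Finset.range j,
        pair (robinJet L R β n) (n + j - i) (Function.update d (K + 1) v i) =
        ∑ i ∈ Finset.range j, pair (robinJet L R β n) (n + j - i) (d i) := fun j hj =>
      Finset.sum_congr rfl fun i hi => by
        have := Finset.mem_range.1 hi
        rw [Function.update_of_ne (by omega)]
    rcases Nat.lt_or_ge K j with hKj | hKj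
    · obtain rfl : j = K + 1 := by omega
      rw [Finset.sum_range_succ, hlow _ le_rfl, Function.update_self, Nat.add_sub_cancel]
      suffices h : pair (robinJet L R β n) n v = t n by rw [h]; simp [t]
      by_cases hn4 : n ≤ 4
      · exact hv n hn4
      -- The only overdetermined equation. As 120 p₅ = 10 p₃ - (2/3) p₁, it requires 120 t₅ = 10 t₃
      -- - (2/3) t₁; here t₁ = 3 L₀₁, t₃ = 0 and t₅ = -L₀₁ / 60.
      · obtain ⟨rfl, rfl⟩ : n = 5 ∧ K = 0 := by omega
        have h1 := hv 1 (by norm_num)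
        have h3 := hv 3 (by norm_num)
        simp only [t, zero_add, Finset.sum_range_one, Nat.sub_zero, hd0, Nat.reduceAdd,
          pair_one_second, pair_three_second] at h1 h3
        simp only [t, zero_add, Finset.sum_range_one, Nat.sub_zero, hd0, Nat.reduceAdd,
          pair_five_second]
        rw [pair_one] at h1
        rw [pair_three] at h3
        rw [pair_five]
        linarith
    · have := hd j hKj n hn
      rw [Finset.sum_congr rfl fun i hi => ?_]
      · exact this
      · have := Finset.mem_range.1 hi
        rw [Function.update_of_ne (by omega)]

lemma sum_mul_jetPoly (J : ℕ → ℕ → ℝ) (N : ℕ) (C : ℤ × ℤ → ℝ) (h : ℝ) :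
    ∑ s ∈ stencil, C s * jetPoly J N (s.1 * h) (s.2 * h)
      = ∑ d ∈ Finset.range (N + 1), h ^ d * pair J d C := by
  simp only [jetPoly_eq_sum, homogPart_smul, pair, Finset.mul_sum]
  rw [Finset.sum_comm]
  simp only [mul_left_comm]

lemma isBigO_of_antidiagonal_sum_eq_zero (X : ℕ → ℕ → ℝ)
    (hX : ∀ k ≤ 6, ∑ i ∈ Finset.range (k + 1), X i (k - i) = 0) :
    (fun h : ℝ => ∑ i ∈ Finset.range 7, ∑ d ∈ Finset.range 7, h ^ i * h ^ d * X i d)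
      =O[𝓝[>] 0] fun h : ℝ => h ^ 7 := by
  have hX0 := hX 0 (by norm_num)
  have hX1 := hX 1 (by norm_num)
  have hX2 := hX 2 (by norm_num)
  have hX3 := hX 3 (by norm_num)
  have hX4 := hX 4 (by norm_num)
  have hX5 := hX 5 (by norm_num)
  have hX6 := hX 6 (by norm_num)
  simp [Finset.sum_range_succ] at hX0 hX1 hX2 hX3 hX4 hX5 hX6
  -- The quotient of the double sum by h^7 once the terms below degree seven cancel; the truncated
  -- subtraction in the exponent is exact on this range.
  let G : ℝ → ℝ := fun h => ∑ i ∈ Finset.range 7, ∑ d ∈ Finset.Ico (7 - i) 7,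
    h ^ (i + d - 7) * X i d
  have hG : G =O[𝓝[>] 0] fun _ => (1 : ℝ) := by
    have : Continuous G := by fun_prop
    exact (this.tendsto 0).isBigO_one ℝ |>.mono nhdsWithin_le_nhds
  refine (((isBigO_refl (fun h : ℝ => h ^ 7) (𝓝[>] 0)).mul hG).congr_left fun h => ?_).congr_right
    fun h => mul_one _
  simp only [G, Finset.sum_range_succ, Finset.sum_range_zero, Finset.sum_Ico_eq_sum_range]
  norm_num [Finset.sum_range_succ]
  linear_combination (-1) * hX0 - h * hX1 - h ^ 2 * hX2 - h ^ 3 * hX3 - h ^ 4 * hX4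
    - h ^ 5 * hX5 - h ^ 6 * hX6

/-- The first two orders of a stencil sum that vanishes to high order. -/
lemma pair_expansion {n N p : ℕ} (hN : n + 2 ≤ N) (hp : n + 2 ≤ p) {C : ℤ × ℤ → ℝ → ℝ} {M : ℝ → ℝ}
    (hM : (fun _ => (1 : ℝ)) =O[𝓝[>] 0] M) (hC : ∀ s ∈ stencil, C s =O[𝓝[>] 0] M)
    (h : (fun h : ℝ => ∑ s ∈ stencil, C s h * jetPoly (robinJet L R β n) N (s.1 * h) (s.2 * h))
      =O[𝓝[>] 0] fun h : ℝ => h ^ p) :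
    (fun h : ℝ => pair (robinJet L R β n) n (fun s => C s h)
      + h * pair (robinJet L R β n) (n + 1) (fun s => C s h)) =O[𝓝[>] 0] fun h => h ^ 2 * M h := by
  obtain ⟨k, rfl⟩ := Nat.exists_eq_add_of_le hN
  obtain ⟨q, rfl⟩ := Nat.exists_eq_add_of_le hp
  have h1 : (fun h : ℝ => ∑ d ∈ Finset.range (k + 1),
      h ^ (2 + d) * pair (robinJet L R β n) (n + (2 + d)) (fun s => C s h))
      =O[𝓝[>] 0] fun h => h ^ 2 * M h := by
    refine IsBigO.fun_sum fun d _ => ?_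
    have e : ∀ h : ℝ, h ^ (2 + d) * pair (robinJet L R β n) (n + (2 + d)) (fun s => C s h) =
      h ^ 2 * (h ^ d * pair (robinJet L R β n) (n + (2 + d)) (fun s => C s h)) := fun h => by
        rw [pow_add]; ring
    simp only [e]
    refine (isBigO_refl (fun h : ℝ => h ^ 2) _).mul ?_
    have hd : (fun h : ℝ => h ^ d) =O[𝓝[>] 0] fun _ => (1 : ℝ) :=
      (((continuous_id.pow d).tendsto (0 : ℝ)).isBigO_one ℝ).mono nhdsWithin_le_nhds
    have hs : (fun h : ℝ => pair (robinJet L R β n) (n + (2 + d)) (fun s => C s h))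
        =O[𝓝[>] 0] M := by
      unfold pair
      exact IsBigO.fun_sum fun s hs => by
        simpa only [mul_comm] using (hC s hs).const_mul_left (homogPart _ _ _ _)
    simpa using hd.mul hs
  -- The majorant `M` is bounded below up to a constant, so the given error, divided by h^n, is
  -- absorbed even if the coefficients are small.
  have h2 : (fun h : ℝ => h ^ (2 + q)) =O[𝓝[>] 0] fun h => h ^ 2 * M h := by
    simp only [pow_add]
    refine (isBigO_refl (fun h : ℝ => h ^ 2) _).mul (IsBigO.trans ?_ hM)
    exact (((continuous_id.pow q).tendsto (0 : ℝ)).isBigO_one ℝ).mono nhdsWithin_le_nhds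
  have h3 : (fun h : ℝ => (h ^ n)⁻¹ * ∑ s ∈ stencil, C s h * jetPoly (robinJet L R β n)
      (n + 2 + k) (s.1 * h) (s.2 * h)) =O[𝓝[>] 0] fun h : ℝ => h ^ (2 + q) := by
    refine ((isBigO_refl (fun h : ℝ => (h ^ n)⁻¹) (𝓝[>] 0)).mul h).congr' EventuallyEq.rfl ?_
    filter_upwards [self_mem_nhdsWithin] with h hh
    have : h ≠ 0 := ne_of_gt hh
    rw [add_assoc, pow_add]
    field_simp
  refine ((h3.trans h2).sub h1).congr' ?_ EventuallyEq.rfl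
  filter_upwards [self_mem_nhdsWithin] with h hh
  have : h ≠ 0 := ne_of_gt hh
  rw [sum_mul_jetPoly (C := fun s => C s h), show n + 2 + k + 1 = n + (2 + (k + 1)) by ring,
    Finset.sum_range_add, Finset.sum_eq_zero (s := Finset.range n), zero_add,
    Finset.sum_range_add]
  · simp only [Finset.sum_range_succ _ 1, Finset.sum_range_one, pow_add h n, add_zero, pow_zero,
      pow_one, mul_assoc, ← Finset.mul_sum]
    simp only [← mul_add]
    rw [inv_mul_cancel_left₀ (pow_ne_zero n this)]
    ring
  · intro d hd
    rw [pair_of_lt (Finset.mem_range.1 hd), mul_zero]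

end Pair

/-! ### Existence of nontrivial solutions and consistency -/

namespace SideRect

variable {D : SideRect} {a u f : ℝ → ℝ → ℝ} {α g : ℝ → ℝ}

theorem exists_solvesSystem (D : SideRect) (a : ℝ → ℝ → ℝ) (α : ℝ → ℝ) :
    ∃ c : ℤ × ℤ → ℕ → ℝ, D.SolvesSystem a α c ∧ ∃ s ∈ stencil, c s 0 ≠ 0 := by
  obtain ⟨d, hd0, hd⟩ := exists_coeff (D.pd fun x y => Real.log (a x y))
    (D.pd fun x y => (a x y)⁻¹) (D.bd α) 6
  refine ⟨fun s i => d i s, ?_, (1, 0), by decide, by simp [hd0, leadWeight]⟩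
  rw [solvesSystem_iff]
  intro n hn
  refine (isBigO_of_antidiagonal_sum_eq_zero (fun i k => pair (D.sysJet a α n) k (d i)) ?_).congr_left
    fun h => ?_
  · intro k hk
    rcases Nat.lt_or_ge k n with hkn | hkn
    · exact Finset.sum_eq_zero fun i _ => pair_of_lt (by omega) _
    -- For i > k - n the degree k - i lies below n, where the jet has no terms.
    · rw [← Finset.sum_subset (Finset.range_subset_range.2 (show k - n + 1 ≤ k + 1 by omega))]
      · have := hd (k - n) (by omega) n (by omega)
        rwa [Nat.add_sub_cancel' hkn] at this
      · intro i hi hi'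
        rw [Finset.mem_range] at hi hi'
        exact pair_of_lt (by omega) _
  · rw [sum_mul_jetPoly (C := fun s => polyC (fun s i => d i s) s h), Finset.sum_comm]
    refine Finset.sum_congr rfl fun k _ => ?_
    simp only [pair, polyC, Finset.mul_sum, Finset.sum_mul]
    rw [Finset.sum_comm]
    refine Finset.sum_congr rfl fun s _ => Finset.sum_congr rfl fun i _ => ?_
    ring

lemma tendsto_pair (J : ℕ → ℕ → ℝ) (n : ℕ) (c : ℤ × ℤ → ℕ → ℝ) :
    Tendsto (fun h => pair J n fun s => polyC c s h) (𝓝[>] 0) (𝓝 (pair J n fun s => c s 0)) :=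
  tendsto_finsetSum _ fun s _ => (tendsto_polyC c s).mul_const _

lemma SolvesSystem.expansion {c : ℤ × ℤ → ℕ → ℝ} (hc : D.SolvesSystem a α c) {n : ℕ} (hn : n ≤ 4) :
    (fun h : ℝ => pair (D.sysJet a α n) n (fun s => polyC c s h)
      + h * pair (D.sysJet a α n) (n + 1) (fun s => polyC c s h)) =O[𝓝[>] 0] fun h => h ^ 2 := by
  simpa [sysJet] using pair_expansion (N := 6) (p := 7) (M := fun _ => (1 : ℝ)) (by omega) (by omega)
    (isBigO_refl _ _) (fun s _ => polyC_isBigO_one c s) (solvesSystem_iff.1 hc n (by omega))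

lemma tendsto_id_nhdsGT : Tendsto (fun h : ℝ => h) (𝓝[>] 0) (𝓝 0) :=
  tendsto_id.mono_left nhdsWithin_le_nhds

lemma SolvesSystem.pair_eq_zero {c : ℤ × ℤ → ℕ → ℝ} (hc : D.SolvesSystem a α c) {n : ℕ}
    (hn : n ≤ 4) : pair (D.sysJet a α n) n (fun s => c s 0) = 0 := by
  have h1 := (tendsto_pair (D.sysJet a α n) n c).add
    (tendsto_id_nhdsGT.mul (tendsto_pair (D.sysJet a α n) (n + 1) c))
  have h2 : Tendsto (fun h : ℝ => h ^ 2) (𝓝[>] 0) (𝓝 0) := by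
    simpa using tendsto_id_nhdsGT.pow 2
  simpa using tendsto_nhds_unique h1 ((hc.expansion hn).trans_tendsto h2)

/-- The case n = 0 of (*): `T_0 = 1 + α(y₀) x + …`, so the sum of the coefficients is of order h,
with a rate that produces the zeroth-order term of the Robin operator. -/
lemma SolvesSystem.tendsto_sum_div {c : ℤ × ℤ → ℕ → ℝ} (hc : D.SolvesSystem a α c) :
    Tendsto (fun h : ℝ => h⁻¹ * ∑ s ∈ stencil, polyC c s h) (𝓝[>] 0)
      (𝓝 (- (α D.y₀ * (c (1, -1) 0 + c (1, 0) 0 + c (1, 1) 0)))) := by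
  have h1 := (inv_mul_isBigO (p := 1) (hc.expansion (n := 0) (by norm_num))).trans_tendsto
    (by simpa using tendsto_id_nhdsGT)
  have h2 := h1.sub (tendsto_pair (D.sysJet a α 0) 1 c)
  rw [zero_sub, sysJet, pair_zero_second] at h2
  simp only [bd, iteratedDeriv_zero] at h2
  refine h2.congr' ?_
  filter_upwards [self_mem_nhdsWithin] with h hh
  have : h ≠ 0 := ne_of_gt hh
  rw [pair_zero, sum_stencil]
  field_simp
  ring

/-- The leading coefficients lie in the kernel of the five functionals, hence are a multiple of
`leadWeight`. The sum of the coefficients yields `α w`, the slopes along the rays yield `w_x`, and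
`w_y` drops out by the pairing of degree 1. -/
theorem SolvesSystem.isConsistent {c : ℤ × ℤ → ℕ → ℝ} (hc : D.SolvesSystem a α c)
    (h0 : ∃ s ∈ stencil, c s 0 ≠ 0) : (D.robinScheme a c).IsConsistent D α := by
  have hv := eq_leadWeight_add_solVec (L := D.pd fun x y => Real.log (a x y))
    (R := D.pd fun x y => (a x y)⁻¹) (β := D.bd α) (fun s => c s 0)
  have hz : ∀ s, solVec (fun n => n.factorial * pair (D.sysJet a α n) n (fun s => c s 0)) s = 0 :=
    fun s => Finset.sum_eq_zero fun n _ => by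
      simp only [hc.pair_eq_zero (Nat.le_of_lt_succ n.isLt), mul_zero]
  have hc' : ∀ s ∈ stencil, c s 0 = c (1, -1) 0 * leadWeight s := fun s hs => by
    have h1 := hv s hs
    have h2 := hz s
    simp only [sysJet] at h2
    rwa [h2, add_zero] at h1
  have hne : c (1, -1) 0 ≠ 0 := fun h => by
    obtain ⟨s, hs, hs'⟩ := h0
    exact hs' (by rw [hc' s hs, h, zero_mul])
  refine ⟨-(c (1, -1) 0 + c (1, 0) 0 + c (1, 1) 0), ?_, fun w hw => ?_⟩
  · rw [hc' (1, 0) (by decide), hc' (1, 1) (by decide)]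
    norm_num [leadWeight]
    intro h
    -- The weights 1, 4, 1 of the column k = 1 add up to 6.
    exact hne (by linarith)
  have hslope : ∀ s ∈ stencil, Tendsto (fun h : ℝ =>
      h⁻¹ * (w (D.l₁ + s.1 * h) (D.y₀ + s.2 * h) - w D.l₁ D.y₀)) (𝓝[>] 0)
      (𝓝 (s.1 * D.dx w D.l₁ D.y₀ + s.2 * D.dy w D.l₁ D.y₀)) := by
    intro s hs
    obtain ⟨b, hb, hr⟩ := exists_rayIn (D := D) hs
    have h1 := hasDerivWithinAt_iff_tendsto_slope.1
      (hw.hasDerivWithinAt_ray hr (left_mem_Icc.2 hb.le))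
    have h2 : 𝓝[>] (0 : ℝ) ≤ 𝓝[Icc 0 b \ {0}] 0 := by
      refine le_inf nhdsWithin_le_nhds (le_principal_iff.2 ?_)
      filter_upwards [Ioc_mem_nhdsGT hb] with h hh
      exact ⟨⟨hh.1.le, hh.2⟩, ne_of_gt hh.1⟩
    refine (by simpa using h1.mono_left h2 : Tendsto _ _ _).congr fun h => ?_
    simp [slope_def_field, div_eq_inv_mul]
  have key := (hc.tendsto_sum_div.mul_const (w D.l₁ D.y₀)).add
    (tendsto_finsetSum stencil fun s hs => (tendsto_polyC c s).mul (hslope s hs))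
  have h1 : pair (D.sysJet a α 1) 1 (fun s => c s 0) = 0 := hc.pair_eq_zero (by norm_num)
  rw [sysJet, pair_one] at h1
  have hlim : -(α D.y₀ * (c (1, -1) 0 + c (1, 0) 0 + c (1, 1) 0)) * w D.l₁ D.y₀
      + ∑ s ∈ stencil, c s 0 * (s.1 * D.dx w D.l₁ D.y₀ + s.2 * D.dy w D.l₁ D.y₀)
      = -(c (1, -1) 0 + c (1, 0) 0 + c (1, 1) 0) * D.robin α w D.y₀ := by
    rw [robin, show derivWithin (fun x => w x D.y₀) (Icc D.l₁ D.l₂) D.l₁ = D.dx w D.l₁ D.y₀ from rfl,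
      sum_stencil]
    push_cast
    linear_combination D.dy w D.l₁ D.y₀ * h1
  rw [hlim] at key
  refine key.congr fun h => ?_
  simp only [SixPointScheme.lhs, robinScheme, mul_assoc, Finset.sum_mul, Finset.mul_sum]
  rw [← Finset.sum_add_distrib]
  refine Finset.sum_congr rfl fun s _ => ?_
  ring

lemma robinScheme_nontrivial {c : ℤ × ℤ → ℕ → ℝ} (h0 : ∃ s ∈ stencil, c s 0 ≠ 0) :
    (D.robinScheme a c).Nontrivial := by
  obtain ⟨s, hs, h⟩ := h0
  exact ⟨s, hs, fun ht => h (tendsto_nhds_unique (tendsto_polyC c s) ht)⟩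

/-! ### The order barrier -/

/-- The polynomial in `x - l₁`, `y - y₀` with the jet `J`. -/
noncomputable def jetFun (D : SideRect) (J : ℕ → ℕ → ℝ) (N : ℕ) (x y : ℝ) : ℝ :=
  jetPoly J N (x - D.l₁) (y - D.y₀)

lemma smoothOn_jetFun (J : ℕ → ℕ → ℝ) (N : ℕ) (r : ℕ∞) : D.SmoothOn r (D.jetFun J N) := by
  unfold SmoothOn jetFun jetPoly
  exact ContDiff.contDiffOn (by fun_prop)

lemma pd_jetFun (J : ℕ → ℕ → ℝ) {N m n : ℕ} (h : m + n ≤ N) :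
    D.pd (D.jetFun J N) m n = J m n := by
  have hs : ∀ p ∈ Lam N, D.SmoothOn (m + n : ℕ) (fun x y => J p.1 p.2 *
      ((x - D.l₁) ^ p.1 * (y - D.y₀) ^ p.2 / ((p.1.factorial : ℝ) * (p.2.factorial : ℝ)))) :=
    fun p _ => ContDiff.contDiffOn (by fun_prop)
  refine (pd_sum (Lam N) hs).trans ?_
  simp only [pd_const_mul, pd_monomial]
  rw [Finset.sum_eq_single_of_mem (m, n) (mem_Lam.2 h)]
  · simp [kron]
  · rintro ⟨i, j⟩ _ hij
    have : ¬ (m = i ∧ n = j) := fun e => hij (by simp [e.1, e.2])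
    simp [kron, this]

/-- If the jet of an exact solution is the jet of a solution of the homogeneous equation, the
derivatives of the source vanish. -/
lemma IsJet.source_eq_zero {L R F J : ℕ → ℕ → ℝ} {N : ℕ} (hR : R 0 0 ≠ 0)
    (h : IsJet L R F (N + 2) J) (h' : IsJet L R (fun _ _ => 0) (N + 2) J) :
    ∀ m n, m + n ≤ N → F m n = 0 := by
  suffices ∀ k m n, m + n = k → k ≤ N → F m n = 0 from fun m n hmn => this _ m n rfl hmn
  intro k
  induction k using Nat.strong_induction_on with
  | _ k ih =>
    intro m n hk hN
    -- Subtracting the two recursions leaves the zero jet with source `F`; at lowest order this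
    -- reads `R 0 0 * F m n = 0`.
    have h0 : IsJet L R F (N + 2) fun _ _ => 0 := fun m n hmn => by
      have e1 := h m n hmn
      have e2 := h' m n hmn
      rw [e2] at e1
      simp only [mul_add, mul_zero, add_zero, zero_add, Finset.sum_add_distrib, neg_zero] at e1 ⊢
      linarith
    have := (h0.mono (show k + 2 ≤ N + 2 by omega)).lowest le_rfl (fun _ _ _ => rfl)
      (fun m n hmn => ih (m + n) (by omega) m n rfl (by omega)) (m := m) (n := n) (by omega)
    simpa [hR] using this

/-- Any smooth `u` is exact for the data it generates. If its jet is the homogeneous Robin jet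
through order N + 2, those data vanish at P through order N, so a scheme using only these
derivatives has right-hand side zero whatever its coefficients are. -/
lemma exists_testSolution (ha : D.SmoothOn ⊤ a) (hpos : ∀ z ∈ D.OmegaBar, 0 < a z.1 z.2)
    (hα : D.SmoothSide ⊤ α) (n N : ℕ) : ∃ f g,
      D.IsExactSolution a α ⊤ (D.jetFun (D.sysJet a α n) (N + 2)) f g ∧
      (∀ i j, i + j ≤ N → D.pd f i j = 0) ∧ ∀ i ≤ N, D.bd g i = 0 := by
  set u := D.jetFun (D.sysJet a α n) (N + 2) with hu_def
  have hu : ∀ r, D.SmoothOn r u := smoothOn_jetFun _ _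
  have hf : D.SmoothOn ⊤ (D.negDivGrad a u) := SmoothOn.negDivGrad (by simpa using ha) (hu _)
  have hux : D.SmoothOn ⊤ (D.dx u) := SmoothOn.dx (hu _)
  have hsol : D.IsExactSolution a α ⊤ u (D.negDivGrad a u) (D.robin α u) :=
    ⟨hu _, hf, (hux.slice_y D.l₁_mem).neg.add (ContDiffOn.mul hα ((hu ⊤).slice_y D.l₁_mem)),
      fun x hx y hy => negDivGrad_eq (ha.of_le le_top) (hu 2) hx hy, fun _ _ => rfl⟩
  refine ⟨_, _, hsol, ?_, fun i hi => ?_⟩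
  · have h1 := isJet_pd (N := N) hpos (ha.of_le le_top) (hu _) (hf.of_le le_top)
      (f := D.negDivGrad a u) (fun _ _ _ _ => rfl)
    have h2 : IsJet (D.pd fun x y => Real.log (a x y)) (D.pd fun x y => (a x y)⁻¹) (fun _ _ => 0)
        (N + 2) (D.pd u) := fun i j hij => by
      rw [pd_jetFun _ (by omega), pd_jetFun _ (by omega), sysJet, isJet_robinJet (N + 2) i j hij]
      congr 1
      refine Finset.sum_congr rfl fun k hk => Finset.sum_congr rfl fun l hl => ?_
      have := Finset.mem_range.1 hk
      have := Finset.mem_range.1 hl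
      rw [pd_jetFun _ (by omega), pd_jetFun _ (by omega), sysJet]
    refine IsJet.source_eq_zero ?_ h1 h2
    rw [pd_zero_zero]
    exact inv_ne_zero (hpos _ D.base_mem).ne'
  · rw [bd_robin (ContDiffOn.of_le hα (by exact_mod_cast le_top)) (hu _) hsol.bc,
      pd_jetFun _ (by omega), sysJet, robinJet_one, neg_add_eq_zero]
    have e : ∀ k ∈ Finset.range (i + 1), (i.choose k : ℝ) * D.bd α (i - k) * D.pd u 0 k =
        if k = n then (i.choose k : ℝ) * D.bd α (i - k) else 0 := fun k hk => by
      have := Finset.mem_range.1 hk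
      rw [pd_jetFun _ (by omega), sysJet, robinJet_zero]
      split_ifs <;> simp
    rw [Finset.sum_congr rfl e, Finset.sum_ite_eq']
    split_ifs with hn
    · rfl
    · rw [Nat.choose_eq_zero_of_lt (by simpa using hn)]; simp

lemma truncation_testSolution (ha : D.SmoothOn ⊤ a) (hpos : ∀ z ∈ D.OmegaBar, 0 < a z.1 z.2)
    (hα : D.SmoothSide ⊤ α) {S : SixPointScheme} {p : ℕ} (hS : S.HasTruncationOrder D a α ⊤ p)
    (n : ℕ) : (fun h : ℝ => ∑ s ∈ stencil, S.C s h *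
      jetPoly (D.sysJet a α n) (S.Kf + S.Kg + 6 + 2) (s.1 * h) (s.2 * h))
      =O[𝓝[>] 0] fun h : ℝ => h ^ (p + 1) := by
  -- `Kf + Kg` covers all data derivatives in the scheme; the additional 6 ensures that the
  -- polynomial has the two lowest orders of every jet with n ≤ 6.
  obtain ⟨f, g, hsol, hf, hg⟩ := exists_testSolution ha hpos hα n (S.Kf + S.Kg + 6)
  have h1 := hS _ f g hsol
  have hr : ∀ h, S.rhs D f g h = 0 := fun h => by
    rw [SixPointScheme.rhs, Finset.sum_eq_zero fun p hp => ?_, Finset.sum_eq_zero fun n hn => ?_,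
      add_zero]
    · rw [hg n (by have := Finset.mem_range.1 hn; omega), zero_mul]
    · rw [hf _ _ (by have := mem_Lam.1 hp; omega), zero_mul]
  simp only [hr, sub_zero, SixPointScheme.lhs, jetFun, add_sub_cancel_left] at h1
  refine ((isBigO_refl (fun h : ℝ => h) (𝓝[>] 0)).mul h1).congr' ?_ ?_
  · filter_upwards [self_mem_nhdsWithin] with h hh
    exact mul_inv_cancel_left₀ (ne_of_gt hh) _
  · filter_upwards with h
    rw [pow_succ']

/-- With m the sum of the absolute values, m ≤ K h (1 + m); for h < 1 / (2K) the term containing m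
is absorbed and m ≤ 2 K h. -/
lemma tendsto_zero_of_isBigO {C : ℤ × ℤ → ℝ → ℝ}
    (h : ∀ s ∈ stencil, C s =O[𝓝[>] 0] fun h => h * (1 + ∑ s ∈ stencil, |C s h|)) :
    ∀ s ∈ stencil, Tendsto (C s) (𝓝[>] 0) (𝓝 0) := by
  set m : ℝ → ℝ := fun h => ∑ s ∈ stencil, |C s h| with hm
  have hm0 : ∀ h, 0 ≤ m h := fun h => Finset.sum_nonneg fun _ _ => abs_nonneg _
  have hmO : m =O[𝓝[>] 0] fun h => h * (1 + m h) := IsBigO.fun_sum fun s hs => (h s hs).abs_left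
  obtain ⟨K, hK, hb⟩ := hmO.exists_pos
  have hmO' : m =O[𝓝[>] 0] fun h => h := by
    refine IsBigO.of_bound (2 * K) ?_
    filter_upwards [hb.bound, Ioo_mem_nhdsGT (show (0 : ℝ) < 1 / (2 * K) by positivity)] with t ht hh
    rw [Real.norm_of_nonneg (hm0 t), Real.norm_of_nonneg
      (mul_nonneg hh.1.le (by linarith [hm0 t]))] at ht
    rw [Real.norm_of_nonneg (hm0 t), Real.norm_of_nonneg hh.1.le]
    have h2 : t * (2 * K) ≤ 1 := ((lt_div_iff₀ (by positivity)).1 hh.2).le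
    nlinarith [mul_le_mul_of_nonneg_right h2 (hm0 t)]
  intro s hs
  refine IsBigO.trans_tendsto (IsBigO.trans (IsBigO.of_bound 1 ?_) hmO') tendsto_id_nhdsGT
  filter_upwards with t
  rw [one_mul, Real.norm_of_nonneg (hm0 t)]
  exact Finset.single_le_sum (f := fun s => |C s t|) (fun _ _ => abs_nonneg _) hs

lemma pair_add_smul (J : ℕ → ℕ → ℝ) (d : ℕ) {v w z : ℤ × ℤ → ℝ} {c : ℝ}
    (h : ∀ s ∈ stencil, v s = c * w s + z s) : pair J d v = c * pair J d w + pair J d z := by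
  rw [pair, pair, pair, Finset.mul_sum, ← Finset.sum_add_distrib]
  exact Finset.sum_congr rfl fun s hs => by rw [h s hs]; ring

/-- A 6-point scheme of order seven is trivial, unless `2 a α + a_x = 0` at the base point. -/
theorem not_nontrivial_of_order_seven (ha : D.SmoothOn ⊤ a) (hpos : ∀ z ∈ D.OmegaBar, 0 < a z.1 z.2)
    (hα : D.SmoothSide ⊤ α) (hne : 2 * a D.l₁ D.y₀ * α D.y₀ + D.pd a 1 0 ≠ 0)
    {S : SixPointScheme} (hS : S.HasTruncationOrder D a α ⊤ 7) : ¬ S.Nontrivial := by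
  rintro ⟨s, hs, hnt⟩
  refine hnt (tendsto_zero_of_isBigO ?_ s hs)
  -- The coefficients are arbitrary functions of h and may be unbounded, so all estimates are
  -- relative to `M`.
  obtain ⟨M, hM⟩ : ∃ M : ℝ → ℝ, ∀ h, M h = 1 + ∑ s ∈ stencil, |S.C s h| := ⟨_, fun _ => rfl⟩
  simp only [← hM]
  have hCM' : ∀ s ∈ stencil, ∀ h, |S.C s h| ≤ M h - 1 := fun s hs h => by
    rw [hM, add_sub_cancel_left]
    exact Finset.single_le_sum (f := fun s => |S.C s h|) (fun _ _ => abs_nonneg _) hs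
  have hM1' : ∀ h, 1 ≤ M h := fun h => by linarith [hCM' s hs h, abs_nonneg (S.C s h)]
  have hM1 : (fun _ => (1 : ℝ)) =O[𝓝[>] 0] M :=
    IsBigO.of_bound 1 (Eventually.of_forall fun h => by
      rw [Real.norm_of_nonneg (zero_le_one.trans (hM1' h)), norm_one, one_mul]
      exact hM1' h)
  have hCM : ∀ s ∈ stencil, S.C s =O[𝓝[>] 0] M := fun s hs =>
    IsBigO.of_bound 1 (Eventually.of_forall fun h => by
      rw [Real.norm_of_nonneg (zero_le_one.trans (hM1' h)), Real.norm_eq_abs, one_mul]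
      linarith [hCM' s hs h])
  set J := D.sysJet a α with hJ
  have hpairM : ∀ n d, (fun h => pair (J n) d fun s => S.C s h) =O[𝓝[>] 0] M := fun n d =>
    IsBigO.fun_sum fun s hs => by
      simpa only [mul_comm] using (hCM s hs).const_mul_left (homogPart (J n) d s.1 s.2)
  have hexp : ∀ n ≤ 6, (fun h : ℝ => pair (J n) n (fun s => S.C s h)
      + h * pair (J n) (n + 1) (fun s => S.C s h)) =O[𝓝[>] 0] fun h => h ^ 2 * M h := fun n hn =>
    pair_expansion (by omega) (by omega) hM1 hCM (truncation_testSolution ha hpos hα hS n)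
  have hsq : (fun h => h ^ 2 * M h) =O[𝓝[>] 0] fun h => h * M h := by
    refine IsBigO.mul ?_ (isBigO_refl _ _)
    refine IsBigO.of_bound 1 ?_
    filter_upwards [Ioo_mem_nhdsGT (show (0 : ℝ) < 1 by norm_num)] with h hh
    rw [Real.norm_of_nonneg (sq_nonneg h), Real.norm_of_nonneg hh.1.le]
    nlinarith [hh.1, hh.2]
  have hlow : ∀ n ≤ 6, (fun h => pair (J n) n fun s => S.C s h) =O[𝓝[>] 0] fun h => h * M h :=
    fun n hn => (((hexp n hn).trans hsq).sub
      ((isBigO_refl (fun h : ℝ => h) _).mul (hpairM n (n + 1)))).congr_left fun h => by ring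
  have hsol : ∀ s, (fun h => solVec (fun n => n.factorial * pair (J n) n fun s => S.C s h) s)
      =O[𝓝[>] 0] fun h => h * M h := fun s =>
    IsBigO.fun_sum fun n _ => ((hlow n (by omega)).const_mul_left _).const_mul_left _
  -- Since 720 p₆ = 2 p₂, the leading terms of the expansions for n = 6 and n = 2 cancel; dividing
  -- by h leaves the next-order pairings.
  have hobs : (fun h => 720 * pair (J 6) 7 (fun s => S.C s h)
      - 2 * pair (J 2) 3 fun s => S.C s h) =O[𝓝[>] 0] fun h => h * M h := by
    have h1 := ((hexp 6 le_rfl).const_mul_left 720).sub ((hexp 2 (by norm_num)).const_mul_left 2)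
    refine ((isBigO_refl (fun h : ℝ => h⁻¹) (𝓝[>] 0)).mul h1).congr' ?_ ?_
    · filter_upwards [self_mem_nhdsWithin] with h hh
      have : h ≠ 0 := ne_of_gt hh
      simp only [hJ, sysJet, pair_six, pair_two]
      field_simp
      ring
    · filter_upwards [self_mem_nhdsWithin] with h hh
      have : h ≠ 0 := ne_of_gt hh
      field_simp
  have hdec : ∀ h, ∀ s ∈ stencil, S.C s h = S.C (1, -1) h * leadWeight s
      + solVec (fun n => n.factorial * pair (J n) n fun s => S.C s h) s := fun h =>
    eq_leadWeight_add_solVec fun s => S.C s h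
  have hpos0 : 0 < a D.l₁ D.y₀ := hpos _ D.base_mem
  have hκ : -(10 / 7) * (2 * D.bd α 0 + D.pd (fun x y => Real.log (a x y)) 1 0) ≠ 0 := by
    have e : D.pd (fun x y => Real.log (a x y)) 1 0 = D.pd a 1 0 / a D.l₁ D.y₀ := by
      simp only [pd_eq, Function.iterate_zero, Function.iterate_one, id]
      exact dx_log (ha.of_le le_top) hpos _ D.l₁_mem _ D.y₀_mem
    rw [e, bd, iteratedDeriv_zero]
    refine mul_ne_zero (by norm_num) fun h => hne ?_
    field_simp at h
    linarith
  have hpairsol : ∀ n d, (fun h => pair (J n) d (solVec fun n => n.factorial *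
      pair (J n) n fun s => S.C s h)) =O[𝓝[>] 0] fun h => h * M h := fun n d =>
    IsBigO.fun_sum fun s hs => by
      simpa only [mul_comm] using (hsol s).const_mul_left (homogPart (J n) d s.1 s.2)
  -- By the decomposition `hdec`, the obstruction is `S.C (1, -1)` times the nonzero constant of
  -- `hκ`, up to the small contribution of `solVec`.
  have hC1 : S.C (1, -1) =O[𝓝[>] 0] fun h => h * M h := by
    have h1 := ((hobs.sub ((hpairsol 6 7).const_mul_left 720)).add
      ((hpairsol 2 3).const_mul_left 2)).const_mul_left
      (-(10 / 7) * (2 * D.bd α 0 + D.pd (fun x y => Real.log (a x y)) 1 0))⁻¹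
    refine h1.congr_left fun h => ?_
    rw [pair_add_smul (J 6) 7 (hdec h), pair_add_smul (J 2) 3 (hdec h), inv_mul_eq_iff_eq_mul₀ hκ,
      ← pair_obstruction (R := D.pd fun x y => (a x y)⁻¹)]
    simp only [hJ, sysJet]
    ring
  intro s hs
  refine ((hC1.const_mul_left (leadWeight s)).add (hsol s)).congr_left fun h => ?_
  rw [hdec h s hs]; ring

lemma IsExactSolution.of_top (h : D.IsExactSolution a α ⊤ u f g) (r : ℕ∞) :
    D.IsExactSolution a α r u f g :=
  ⟨h.smooth_u.of_le le_top, h.smooth_f.of_le le_top,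
    ContDiffOn.of_le h.smooth_g (by exact_mod_cast le_top), h.pde, h.bc⟩

theorem exists_scheme_order_six (ha : D.SmoothOn ⊤ a) (hpos : ∀ z ∈ D.OmegaBar, 0 < a z.1 z.2)
    (hα : D.SmoothSide ⊤ α) :
    ∃ S : SixPointScheme, S.Nontrivial ∧ S.HasTruncationOrder D a α ⊤ 6 := by
  obtain ⟨c, hc, h0⟩ := D.exists_solvesSystem a α
  exact ⟨D.robinScheme a c, robinScheme_nontrivial h0, fun u f g h =>
    hc.hasTruncationOrder hpos (ha.of_le le_top) (ContDiffOn.of_le hα (by exact_mod_cast le_top))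
      u f g (h.of_top 5)⟩

theorem order_le_six (ha : D.SmoothOn ⊤ a) (hpos : ∀ z ∈ D.OmegaBar, 0 < a z.1 z.2)
    (hα : D.SmoothSide ⊤ α) (hne : 2 * a D.l₁ D.y₀ * α D.y₀ + D.pd a 1 0 ≠ 0)
    {S : SixPointScheme} (hS : S.Nontrivial) {p : ℕ} (hp : S.HasTruncationOrder D a α ⊤ p) :
    p ≤ 6 := by
  by_contra! h
  refine not_nontrivial_of_order_seven ha hpos hα hne (fun u f g hu => (hp u f g hu).trans ?_) hS
  refine IsBigO.of_bound 1 ?_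
  filter_upwards [Ioo_mem_nhdsGT (show (0 : ℝ) < 1 by norm_num)] with t ht
  rw [Real.norm_of_nonneg (pow_nonneg ht.1.le _), Real.norm_of_nonneg (pow_nonneg ht.1.le _),
    one_mul]
  exact pow_le_pow_of_le_one ht.1.le ht.2.le h

end SideRect

theorem theorem2p2 (D : SideRect) :
    (∀ (a : ℝ → ℝ → ℝ) (α : ℝ → ℝ), D.SmoothOn 6 a → (∀ z ∈ D.OmegaBar, 0 < a z.1 z.2) →
      D.SmoothSide 5 α →
        (∀ c : ℤ × ℤ → ℕ → ℝ, D.SolvesSystem a α c →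
          (D.robinScheme a c).HasTruncationOrder D a α 5 6 ∧
          ((∃ s ∈ stencil, c s 0 ≠ 0) → (D.robinScheme a c).IsConsistent D α)) ∧
        (∃ c : ℤ × ℤ → ℕ → ℝ, D.SolvesSystem a α c ∧ ∃ s ∈ stencil, c s 0 ≠ 0)) ∧
    IsGreatest {p : ℕ | ∀ (a : ℝ → ℝ → ℝ) (α : ℝ → ℝ), D.SmoothOn ⊤ a →
      (∀ z ∈ D.OmegaBar, 0 < a z.1 z.2) → D.SmoothSide ⊤ α →
        ∃ S : SixPointScheme, S.Nontrivial ∧ S.HasTruncationOrder D a α ⊤ p} 6 ∧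
    (∀ (a : ℝ → ℝ → ℝ) (α : ℝ → ℝ), D.SmoothOn ⊤ a → (∀ z ∈ D.OmegaBar, 0 < a z.1 z.2) →
      D.SmoothSide ⊤ α → 2 * a D.l₁ D.y₀ * α D.y₀ + D.pd a 1 0 ≠ 0 →
        IsGreatest {p : ℕ | ∃ S : SixPointScheme,
          S.Nontrivial ∧ S.HasTruncationOrder D a α ⊤ p} 6) := by
  refine ⟨fun a α ha hpos hα => ⟨fun c hc => ⟨hc.hasTruncationOrder hpos ha hα, hc.isConsistent⟩,
    D.exists_solvesSystem a α⟩, ⟨fun a α ha hpos hα => SideRect.exists_scheme_order_six ha hpos hα,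
    fun p hp => ?_⟩, fun a α ha hpos hα hne => ⟨SideRect.exists_scheme_order_six ha hpos hα, ?_⟩⟩
  -- The constants a = α = 1 give 2aα + a_x = 2 ≠ 0, so a bound valid for all pairs cannot exceed
  -- six.
  · have h1 : D.SmoothOn ⊤ fun _ _ => 1 := contDiffOn_const
    have h2 : D.SmoothSide ⊤ fun _ => 1 := contDiffOn_const
    obtain ⟨S, hS, hSp⟩ := hp (fun _ _ => 1) (fun _ => 1) h1 (fun _ _ => one_pos) h2
    refine SideRect.order_le_six h1 (fun _ _ => one_pos) h2 ?_ hS hSp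
    simp [SideRect.pd]
  · rintro p ⟨S, hS, hSp⟩
    exact SideRect.order_le_six ha hpos hα hne hS hSp
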